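/- Let $k$ be an algebraically closed field of characteristic zero, $\mathcal C$ a fusion category over $k$ (a semisimple rigid $k$-linear monoidal category with finitely many isomorphism classes of simple objects, finite-dimensional Hom spaces and simple unit object), and $G$ a finite group acting on $\mathcal C$ by $k$-linear tensor autoequivalences $\rho^g$, with coherent monoidal isomorphisms $\rho_2^{g,h}:\rho^g\rho^h\to\rho^{gh}$ and $\rho_0:\mathrm{id}\to\rho^e$, and monoidal structures $(\rho^g_2)_{X,X'}:\rho^g(X\otimes X')\to\rho^g(X)\otimes\rho^g(X')$. The objects of the equivariantization $\mathcal C^G$ are pairs $(X,\mu)$ with isomorphisms $\mu^g:\rho^g(X)\to X$ such that $\mu^g\rho^g(\mu^h)=\mu^{gh}(\rho_2^{g,h})_X$ and $\mu^e(\rho_0)_X=\mathrm{id}$; morphisms are the morphisms of $\mathcal C$ compatible with the $\mu^g$; and $(X,\mu)\otimes(X',\mu')=(X\otimes X',((\mu^g\otimes\mu'^g)(\rho^g_2)_{X,X'})_g)$. For a simple object $Y$ of $\mathcal C$ let $G_Y=\{g\in G:\rho^g(Y)\simeq Y\}$, choose isomorphisms $c_Y^g:\rho^g(Y)\to Y$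 $(g\in G_Y)$, and define $\tilde\alpha_Y:G_Y\times G_Y\to k^*$ by $$\tilde\alpha_Y(g,h)^{-1}\,\mathrm{id}_Y=c_Y^g\,\rho^g(c_Y^h)\,(\rho_2^{g,h})_Y^{-1}\,(c_Y^{gh})^{-1}.$$ A projective representation $\pi$ of a group with factor set $\alpha$ on a $k$-space $V_\pi$ is a family of invertible operators with $\pi(g)\pi(h)=\alpha(g,h)\pi(gh)$; if $\pi,\sigma$ are projective representations of a group $T$ with the same factor set, $m_T(\pi,\sigma)$ denotes the dimension of the space of linear maps $V_\pi\to V_\sigma$ commuting with the operators of $T$. Let $\pi$ be a finite-dimensional irreducible projective representation of $G_Y$ with factor set $\tilde\alpha_Y$, and let $\mathcal R_Y$ be a set of representatives of the left cosets $G/G_Y$. Let $S_{Y,\pi}$ be the object $\bigoplus_{t\in\mathcal R_Y}\rho^t(V_\pi\otimes Y)$ of $\mathcal C^G$, where, with $\nu^h=\pi(h)\otimes c_Y^h$ for $h\in G_Y$, the component $\rho^g\rho^t(V_\pi\otimes Y)\to\rho^s(V_\pi\otimes Y)$ of $\mu^g$ is $\rho^s(\nu^h)(\rho_2^{s,h})^{-1}\rho_2^{g,t}$,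 with $gt=sh$, $s\in\mathcal R_Y$, $h\in G_Y$. Let $U,Y,Z$ be simple objects of $\mathcal C$, with choices $c_U,c_Y,c_Z$ and $\mathcal R_U,\mathcal R_Y,\mathcal R_Z$ as above, and let $\delta,\pi,\gamma$ be finite-dimensional irreducible projective representations of $G_U,G_Y,G_Z$ with factor sets $\tilde\alpha_U,\tilde\alpha_Y,\tilde\alpha_Z$. For $t,s\in G$ put $T=G_U\cap tG_Yt^{-1}\cap sG_Zs^{-1}$, ${}^t\pi(g)=\pi(t^{-1}gt)$, ${}^s\gamma(g)=\gamma(s^{-1}gs)$, and let $\tau_U^{t,s}(Y,Z)$ be the projective representation of $T$ on $\mathrm{Hom}_{\mathcal C}(U,\rho^t(Y)\otimes\rho^s(Z))$ given by $$g\cdot f=\big(({}^tc_Y)^g\otimes({}^sc_Z)^g\big)\,(\rho^g_2)_{\rho^t(Y),\rho^s(Z)}\,\rho^g(f)\,(c_U^g)^{-1},\qquad ({}^tc_Y)^g=\rho^t(c_Y^{t^{-1}gt})(\rho_2^{t,t^{-1}gt})_Y^{-1}(\rho_2^{g,t})_Y,$$ and similarly for ${}^sc_Z$. Then ${}^t\pi|_T\otimes{}^s\gamma|_T\otimes\tau_U^{t,s}(Y,Z)$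 has the same factor set $\tilde\alpha_U|_T$ as $\delta|_T$. **Claim.** $S_{U,\delta}$ is a constituent (that is, it is simple and isomorphic to a subobject) of $S_{Y,\pi}\otimes S_{Z,\gamma}$ in $\mathcal C^G$ if and only if there exist $t\in\mathcal R_Y$ (representing a coset in $G/G_Y$) and $s\in\mathcal R_Z$ (representing a coset in $G/G_Z$) such that (a) $\mathrm{Hom}_{\mathcal C}(U,\rho^t(Y)\otimes\rho^s(Z))\neq 0$, and (b) $m_T\big(\delta|_T,\ {}^t\pi|_T\otimes{}^s\gamma|_T\otimes\tau_U^{t,s}(Y,Z)\big)\neq 0$. -/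

import Mathlib

open CategoryTheory CategoryTheory.Limits MonoidalCategory

universe v u

attribute [local instance] Abelian.hasFiniteBiproducts

/-- A fusion category over `k`: a semisimple rigid `k`-linear monoidal category with finitely many
isomorphism classes of simple objects, finite-dimensional Hom spaces and simple unit object. -/
class IsFusionCategory (k : Type*) [Field k] (C : Type u) [Category.{v} C] [Abelian C] [Linear k C]
    [MonoidalCategory C] [MonoidalPreadditive C] [MonoidalLinear k C] [RigidCategory C] :
    Prop where
  finiteDimensional_hom : ∀ X Y : C, FiniteDimensional k (X ⟶ Y)
  semisimple : ∀ X : C, ∃ (n : ℕ) (S : Fin n → C),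
    (∀ i, Simple (S i)) ∧ Nonempty (X ≅ ⨁ S)
  finite_simples : ∃ (n : ℕ) (S : Fin n → C), ∀ X : C, Simple X → ∃ i, Nonempty (X ≅ S i)
  simple_unit : Simple (𝟙_ C)

attribute [instance] IsFusionCategory.finiteDimensional_hom

/-- An action of a group `G` on a `k`-linear category `C` by `k`-linear autoequivalences: functors
`F g` (written `ρ^g`) with coherent isomorphisms `mul g h : ρ^g ρ^h ≅ ρ^{gh}` and
`one : id ≅ ρ^e`. (In Mathlib `F h ⋙ F g` is "first `F h`, then `F g`".) Each `F g` is an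
equivalence because of `mul` and `one`. -/
structure LinearAction (k : Type*) [Field k] (G : Type*) [Group G] (C : Type u) [Category.{v} C]
    [Preadditive C] [Linear k C] where
  F : G → C ⥤ C
  additive : ∀ g, (F g).Additive
  linear : ∀ g, (F g).Linear k
  mul : ∀ g h, F h ⋙ F g ≅ F (g * h)
  one : 𝟭 C ≅ F 1
  assoc : ∀ (a b c : G) (X : C),
    (mul a b).hom.app ((F c).obj X) ≫ (mul (a * b) c).hom.app X ≫
        eqToHom (congrArg (fun g => (F g).obj X) (mul_assoc a b c)) =
      (F a).map ((mul b c).hom.app X) ≫ (mul a (b * c)).hom.app X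
  one_left : ∀ (a : G) (X : C),
    one.hom.app ((F a).obj X) ≫ (mul 1 a).hom.app X =
      eqToHom (congrArg (fun g => (F g).obj X) (one_mul a).symm)
  one_right : ∀ (a : G) (X : C),
    (F a).map (one.hom.app X) ≫ (mul a 1).hom.app X =
      eqToHom (congrArg (fun g => (F g).obj X) (mul_one a).symm)

/-- An action of `G` on a monoidal `k`-linear category by tensor autoequivalences: every `ρ^g` is a
(strong) monoidal functor and the structure isomorphisms are monoidal. -/
structure TensorAction (k : Type*) [Field k] (G : Type*) [Group G] (C : Type u) [Category.{v} C]
    [Preadditive C] [Linear k C] [MonoidalCategory C] extends LinearAction k G C where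
  monoidal : ∀ g, (F g).Monoidal
  mul_monoidal : ∀ g h, NatTrans.IsMonoidal (mul g h).hom
  one_monoidal : NatTrans.IsMonoidal one.hom

attribute [instance] LinearAction.additive LinearAction.linear TensorAction.monoidal
  TensorAction.mul_monoidal TensorAction.one_monoidal

noncomputable section

section Linear

variable {k : Type*} [Field k] {G : Type*} [Group G] {C : Type u} [Category.{v} C]

namespace LinearAction

section Preadditive

variable [Preadditive C] [Linear k C]

/-- The structure isomorphism `ρ^g ρ^h ≅ ρ^k` when `gh = k`. -/
def mulIso (ρ : LinearAction k G C) {g h l : G} (e : g * h = l) : ρ.F h ⋙ ρ.F g ≅ ρ.F l :=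
  ρ.mul g h ≪≫ eqToIso (congrArg ρ.F e)

theorem mulIso_rfl (ρ : LinearAction k G C) (g h : G) :
    ρ.mulIso (rfl : g * h = g * h) = ρ.mul g h := by
  simp [mulIso]

theorem mulIso_assoc (ρ : LinearAction k G C) {a b c ab bc abc : G} (h1 : a * b = ab)
    (h2 : b * c = bc) (h3 : ab * c = abc) (h4 : a * bc = abc) (X : C) :
    (ρ.mulIso h1).hom.app ((ρ.F c).obj X) ≫ (ρ.mulIso h3).hom.app X =
      (ρ.F a).map ((ρ.mulIso h2).hom.app X) ≫ (ρ.mulIso h4).hom.app X := by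
  subst h1 h2 h4
  have := ρ.assoc a b c X
  simp only [mulIso, Iso.trans_hom, eqToIso.hom, NatTrans.comp_app, eqToHom_app, eqToHom_refl,
    Category.comp_id] at this ⊢
  exact this

/-- Restriction of an action to a subgroup. -/
def restrict (ρ : LinearAction k G C) (H : Subgroup G) : LinearAction k H C where
  F h := ρ.F h
  additive h := ρ.additive h
  linear h := ρ.linear h
  mul g h := ρ.mul g h
  one := ρ.one
  assoc a b c X := ρ.assoc a b c X
  one_left a X := ρ.one_left a X
  one_right a X := ρ.one_right a X

/-- The inertia subgroup `G_Y = {g | ρ^g(Y) ≅ Y}`. -/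
def inertia (ρ : LinearAction k G C) (Y : C) : Subgroup G where
  carrier := {g | Nonempty ((ρ.F g).obj Y ≅ Y)}
  one_mem' := ⟨(ρ.one.app Y).symm⟩
  mul_mem' := by
    rintro a b ⟨i⟩ ⟨j⟩
    exact ⟨((ρ.mul a b).app Y).symm ≪≫ (ρ.F a).mapIso j ≪≫ i⟩
  inv_mem' := by
    rintro a ⟨i⟩
    exact ⟨(ρ.F a⁻¹).mapIso i.symm ≪≫ (ρ.mulIso (inv_mul_cancel a)).app Y ≪≫
      (ρ.one.app Y).symm⟩

/-- A choice of isomorphisms `c^g : ρ^g(Y) ≅ Y` for `g ∈ G_Y`. -/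
abbrev InertiaIsos (ρ : LinearAction k G C) (Y : C) : Type _ :=
  ∀ g : ρ.inertia Y, (ρ.F g).obj Y ≅ Y

/-- The automorphism `c^g ρ^g(c^h) (ρ₂^{g,h})⁻¹ (c^{gh})⁻¹` of `Y`. -/
def obstruction (ρ : LinearAction k G C) {Y : C} (c : ρ.InertiaIsos Y) (g h : ρ.inertia Y) :
    Y ⟶ Y :=
  (c (g * h)).inv ≫ (ρ.mul g h).inv.app Y ≫ (ρ.F g).map (c h).hom ≫ (c g).hom

end Preadditive

/-- The subgroup `tHt⁻¹`. -/
def conj (t : G) (H : Subgroup G) : Subgroup G where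
  carrier := {g | t⁻¹ * g * t ∈ H}
  one_mem' := by simp
  mul_mem' := by
    intro a b ha hb
    have := H.mul_mem ha hb
    simpa [mul_assoc] using this
  inv_mem' := by
    intro a ha
    have := H.inv_mem ha
    simpa [mul_assoc] using this

/-- The homomorphism `tHt⁻¹ → H`, `g ↦ t⁻¹gt`. -/
def conjHom (t : G) (H : Subgroup G) : conj t H →* H where
  toFun g := ⟨t⁻¹ * g * t, g.2⟩
  map_one' := by ext; simp
  map_mul' a b := by ext; simp [mul_assoc]

end LinearAction

/-- The scalar by which an endomorphism of a simple object acts. -/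
def schurScalar (k : Type*) [Field k] [IsAlgClosed k] {C : Type u} [Category.{v} C] [Abelian C]
    [Linear k C] {Y : C} [Simple Y] [FiniteDimensional k (Y ⟶ Y)] (f : Y ⟶ Y) : k :=
  (endomorphism_simple_eq_smul_id k f).choose

theorem schurScalar_spec (k : Type*) [Field k] [IsAlgClosed k] {C : Type u} [Category.{v} C]
    [Abelian C] [Linear k C] {Y : C} [Simple Y] [FiniteDimensional k (Y ⟶ Y)] (f : Y ⟶ Y) :
    schurScalar k f • 𝟙 Y = f :=
  (endomorphism_simple_eq_smul_id k f).choose_spec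

variable [Abelian C] [Linear k C]

namespace LinearAction

/-- The factor set `α̃_Y` attached to `c`:
`α̃_Y(g,h)⁻¹ id_Y = c^g ρ^g(c^h) (ρ₂^{g,h})⁻¹ (c^{gh})⁻¹`. -/
def factorSet [IsAlgClosed k] (ρ : LinearAction k G C) {Y : C} [Simple Y]
    [FiniteDimensional k (Y ⟶ Y)] (c : ρ.InertiaIsos Y) (g h : ρ.inertia Y) : k :=
  (schurScalar k (ρ.obstruction c g h))⁻¹

theorem factorSet_spec [IsAlgClosed k] (ρ : LinearAction k G C) {Y : C} [Simple Y]
    [FiniteDimensional k (Y ⟶ Y)] (c : ρ.InertiaIsos Y) (g h : ρ.inertia Y) :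
    (ρ.factorSet c g h)⁻¹ • 𝟙 Y = ρ.obstruction c g h := by
  rw [factorSet, inv_inv, schurScalar_spec]

theorem factorSet_ne_zero [IsAlgClosed k] (ρ : LinearAction k G C) {Y : C} [Simple Y]
    [FiniteDimensional k (Y ⟶ Y)] (c : ρ.InertiaIsos Y) (g h : ρ.inertia Y) :
    ρ.factorSet c g h ≠ 0 := by
  intro h0
  have h1 := ρ.factorSet_spec c g h
  rw [h0, inv_zero, zero_smul] at h1
  have : IsIso (ρ.obstruction c g h) := by
    unfold obstruction
    infer_instance
  rw [← h1] at this
  exact id_nonzero Y ((isIsoZeroEquiv Y Y) this).1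

end LinearAction

/-- A projective representation of `G` on `V` with factor set `α`, in the convention
`π(g)π(h) = α(g,h)π(gh)`. It follows that `π(e) = α(e,e) id`, so `π(e) = id` for normalized `α`. -/
structure ProjRep {k : Type*} [Field k] {G : Type*} [Group G] (α : G → G → k) (V : Type*)
    [AddCommGroup V] [Module k V] where
  toFun : G → (V ≃ₗ[k] V)
  mul : ∀ g h, (toFun g).toLinearMap ∘ₗ (toFun h).toLinearMap =
    α g h • (toFun (g * h)).toLinearMap

namespace ProjRep

variable {k : Type*} [Field k] {G H : Type*} [Group G] [Group H] {V W : Type*} [AddCommGroup V]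
  [Module k V] [AddCommGroup W] [Module k W] {α β : G → G → k}

/-- Irreducibility: `V ≠ 0` and the only invariant subspaces are `0` and `V`. -/
def IsIrreducible (π : ProjRep α V) : Prop :=
  Nontrivial V ∧ ∀ W : Submodule k V, (∀ g, ∀ x ∈ W, π.toFun g x ∈ W) → W = ⊥ ∨ W = ⊤

/-- The pull-back of a projective representation along a group homomorphism (restriction to a
subgroup, conjugation). -/
def comap (π : ProjRep α V) (f : H →* G) : ProjRep (fun g h => α (f g) (f h)) V where
  toFun g := π.toFun (f g)
  mul g h := by rw [π.mul, map_mul]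

/-- The tensor product of projective representations. -/
def tensor (π : ProjRep α V) (σ : ProjRep β W) :
    ProjRep (fun g h => α g h * β g h) (TensorProduct k V W) where
  toFun g := TensorProduct.congr (π.toFun g) (σ.toFun g)
  mul g h := by
    have : ∀ g, (TensorProduct.congr (π.toFun g) (σ.toFun g)).toLinearMap =
        TensorProduct.map (π.toFun g).toLinearMap (σ.toFun g).toLinearMap := fun g => rfl
    rw [this, this, this, ← TensorProduct.map_comp, π.mul, σ.mul, TensorProduct.map_smul_left,
      TensorProduct.map_smul_right, smul_smul]

/-- The space of linear maps `V → W` commuting with the operators of two projective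
representations. When both have the same factor set `α`, it is `Hom_{k_α G}(V, W)`. -/
def intertwiners (π : ProjRep α V) (σ : ProjRep β W) : Submodule k (V →ₗ[k] W) where
  carrier := {φ | ∀ g, φ ∘ₗ (π.toFun g).toLinearMap = (σ.toFun g).toLinearMap ∘ₗ φ}
  zero_mem' := by
    intro g
    simp
  add_mem' := by
    intro a b ha hb g
    rw [LinearMap.add_comp, LinearMap.comp_add, ha g, hb g]
  smul_mem' := by
    intro r a ha g
    rw [LinearMap.smul_comp, LinearMap.comp_smul, ha g]

/-- The multiplicity (intertwining number) `m_G(π, σ) = dim Hom_{k_α G}(V_π, V_σ)` of projective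
representations with the same factor set `α`. -/
def multiplicity (π : ProjRep α V) (σ : ProjRep β W) : ℕ :=
  Module.finrank k (π.intertwiners σ)

/-- A family of operators satisfying the multiplication rule, with the operator of `e`
bijective, consists of invertible operators. -/
def ofLinearMap (α : G → G → k) (f : G → V →ₗ[k] V) (hα : ∀ g h, α g h ≠ 0)
    (h1 : Function.Bijective (f 1)) (hf : ∀ g h, f g ∘ₗ f h = α g h • f (g * h)) :
    ProjRep α V where
  toFun g := LinearEquiv.ofBijective (f g) (by
    have hs : ∀ r : k, r ≠ 0 → Function.Bijective (r • f 1) := fun r hr => by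
      have := (LinearEquiv.smulOfNeZero k V r hr).bijective.comp h1
      exact this
    constructor
    · have := hf g⁻¹ g
      rw [inv_mul_cancel] at this
      have h2 := (hs _ (hα g⁻¹ g)).1
      rw [← this] at h2
      exact Function.Injective.of_comp h2
    · have := hf g g⁻¹
      rw [mul_inv_cancel] at this
      have h2 := (hs _ (hα g g⁻¹)).2
      rw [← this] at h2
      exact Function.Surjective.of_comp h2)
  mul g h := hf g h

end ProjRep

/-- An equivariant object `(X, μ)` of `C`. The maps `μ^g` are automatically isomorphisms, see
`EquivariantObject.isIso_act`. -/
structure EquivariantObject (ρ : LinearAction k G C) where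
  obj : C
  act : ∀ g, (ρ.F g).obj obj ⟶ obj
  act_mul : ∀ g h, (ρ.F g).map (act h) ≫ act g = (ρ.mul g h).hom.app obj ≫ act (g * h)
  act_one : ρ.one.hom.app obj ≫ act 1 = 𝟙 obj

namespace EquivariantObject

variable {ρ : LinearAction k G C}

theorem act_mulIso (X : EquivariantObject ρ) {g h l : G} (e : g * h = l) :
    (ρ.F g).map (X.act h) ≫ X.act g = (ρ.mulIso e).hom.app X.obj ≫ X.act l := by
  subst e
  rw [LinearAction.mulIso_rfl, X.act_mul]

theorem isIso_act (X : EquivariantObject ρ) (g : G) : IsIso (X.act g) := by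
  have key : ∀ a : G, ∃ i : X.obj ⟶ (ρ.F a).obj ((ρ.F a⁻¹).obj X.obj), IsIso i ∧
      i ≫ (ρ.F a).map (X.act a⁻¹) ≫ X.act a = 𝟙 _ := by
    intro a
    refine ⟨ρ.one.hom.app X.obj ≫ (ρ.mulIso (mul_inv_cancel a)).inv.app X.obj, inferInstance, ?_⟩
    rw [X.act_mulIso (mul_inv_cancel a), Category.assoc, Iso.inv_hom_id_app_assoc, X.act_one]
  obtain ⟨i, hi, h⟩ := key g
  have hs : IsSplitEpi (X.act g⁻¹) := by
    obtain ⟨j, _, h'⟩ := key g⁻¹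
    exact IsSplitEpi.mk' ⟨j ≫ (ρ.F g⁻¹).map (X.act g⁻¹⁻¹), by simpa using h'⟩
  have he : Epi (i ≫ (ρ.F g).map (X.act g⁻¹)) := inferInstance
  refine ⟨⟨i ≫ (ρ.F g).map (X.act g⁻¹), ?_, by simpa using h⟩⟩
  rw [← cancel_epi (i ≫ (ρ.F g).map (X.act g⁻¹)), ← Category.assoc, Category.assoc i, h]
  simp

/-- A morphism `(X, μ) → (X', μ')` of equivariant objects. -/
@[ext]
structure Hom (X Y : EquivariantObject ρ) where
  hom : X.obj ⟶ Y.obj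
  comm : ∀ g, X.act g ≫ hom = (ρ.F g).map hom ≫ Y.act g

/-- The equivariantization `C^G` as a category. -/
instance : Category (EquivariantObject ρ) where
  Hom := Hom
  id X := ⟨𝟙 _, by simp⟩
  comp f g := ⟨f.hom ≫ g.hom, fun a => by
    rw [← Category.assoc, f.comm, Category.assoc, g.comm, Functor.map_comp, Category.assoc]⟩
  id_comp f := by
    ext
    exact Category.id_comp _
  comp_id f := by
    ext
    exact Category.comp_id _
  assoc f g h := by
    ext
    exact Category.assoc _ _ _

instance : HasZeroMorphisms (EquivariantObject ρ) where
  zero X Y := ⟨⟨0, by simp⟩⟩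
  comp_zero f Z := by
    apply Hom.ext
    exact Limits.comp_zero
  zero_comp X Y Z f := by
    apply Hom.ext
    exact Limits.zero_comp

end EquivariantObject

/-- `S` is a constituent of `X`: it is a simple object and is isomorphic to a subobject of `X`. -/
def IsConstituent {D : Type*} [Category D] [HasZeroMorphisms D] (S X : D) : Prop :=
  Simple S ∧ ∃ i : S ⟶ X, Mono i

/-- The morphism `F(⨁ X_j) → Z` with components `φ_j : F(X_j) → Z`. -/
def mapDesc {J : Type*} [Finite J] (F : C ⥤ C) (X : J → C) {Z : C}
    (φ : ∀ j, F.obj (X j) ⟶ Z) : F.obj (⨁ X) ⟶ Z :=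
  letI := Fintype.ofFinite J
  ∑ j, F.map (biproduct.π X j) ≫ φ j

theorem map_ι_mapDesc {J : Type*} [Finite J] (F : C ⥤ C) [F.Additive] (X : J → C) {Z : C}
    (φ : ∀ j, F.obj (X j) ⟶ Z) (j : J) : F.map (biproduct.ι X j) ≫ mapDesc F X φ = φ j := by
  classical
  let _ := Fintype.ofFinite J
  rw [mapDesc, Preadditive.comp_sum, Finset.sum_eq_single j]
  · rw [← Category.assoc, ← F.map_comp, biproduct.ι_π_self, F.map_id, Category.id_comp]
  · intro i _ hi
    rw [← Category.assoc, ← F.map_comp, biproduct.ι_π_ne _ hi.symm, F.map_zero, zero_comp]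
  · intro hj
    exact absurd (Finset.mem_univ j) hj

theorem map_biproduct_hom_ext {J : Type*} [Finite J] (F : C ⥤ C) [F.Additive] (X : J → C) {Z : C}
    {f g : F.obj (⨁ X) ⟶ Z}
    (h : ∀ j, F.map (biproduct.ι X j) ≫ f = F.map (biproduct.ι X j) ≫ g) : f = g := by
  let _ := Fintype.ofFinite J
  have key : ∑ j, F.map (biproduct.π X j) ≫ F.map (biproduct.ι X j) = 𝟙 _ := by
    simp only [← F.map_comp]
    rw [← F.map_sum, ← F.map_id]
    congr 1
    refine biproduct.hom_ext' _ _ fun j => ?_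
    rw [Preadditive.comp_sum, Category.comp_id, Finset.sum_eq_single j]
    · rw [← Category.assoc, biproduct.ι_π_self, Category.id_comp]
    · intro i _ hi
      rw [← Category.assoc, biproduct.ι_π_ne _ hi.symm, zero_comp]
    · intro hj
      exact absurd (Finset.mem_univ j) hj
  rw [← Category.id_comp f, ← Category.id_comp g, ← key, Preadditive.sum_comp,
    Preadditive.sum_comp]
  refine Finset.sum_congr rfl fun j _ => ?_
  rw [Category.assoc, Category.assoc, h]

/-- `V ⊗ Y` for a finite-dimensional space `V`: a direct sum of copies of `Y` indexed by a basis
of `V`. -/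
abbrev copower (k : Type*) [Field k] (V : Type*) [AddCommGroup V] [Module k V]
    (Y : C) : C :=
  ⨁ fun _ : Fin (Module.finrank k V) => Y

/-- The morphism `a ⊗ f : F(V ⊗ Y) = V ⊗ F(Y) → V ⊗ Z` for `a : V → V` and `f : F(Y) → Z`. -/
def copowerMap {V : Type*} [AddCommGroup V] [Module k V] [FiniteDimensional k V]
    (F : C ⥤ C) [F.Additive] (a : V →ₗ[k] V) {Y Z : C} (f : F.obj Y ⟶ Z) :
    F.obj (copower k V Y) ⟶ copower k V Z :=
  mapDesc F _ fun i => ∑ j, LinearMap.toMatrix (Module.finBasis k V) (Module.finBasis k V) a j i •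
    (f ≫ biproduct.ι (fun _ : Fin (Module.finrank k V) => Z) j)

theorem map_ι_copowerMap {V : Type*} [AddCommGroup V] [Module k V] [FiniteDimensional k V]
    (F : C ⥤ C) [F.Additive] (a : V →ₗ[k] V) {Y Z : C} (f : F.obj Y ⟶ Z)
    (i : Fin (Module.finrank k V)) :
    F.map (biproduct.ι (fun _ : Fin (Module.finrank k V) => Y) i) ≫ copowerMap F a f =
      ∑ j, LinearMap.toMatrix (Module.finBasis k V) (Module.finBasis k V) a j i •
        (f ≫ biproduct.ι (fun _ : Fin (Module.finrank k V) => Z) j) :=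
  map_ι_mapDesc F _ _ i

theorem copowerMap_comp {V : Type*} [AddCommGroup V] [Module k V] [FiniteDimensional k V]
    (F F' : C ⥤ C) [F.Additive] [F'.Additive] [F.Linear k] (a b : V →ₗ[k] V) {X Y Z : C}
    (f : F'.obj X ⟶ Y) (f' : F.obj Y ⟶ Z) :
    F.map (copowerMap F' a f) ≫ copowerMap F b f' =
      copowerMap (F' ⋙ F) (b ∘ₗ a) (F.map f ≫ f') := by
  apply map_biproduct_hom_ext (F' ⋙ F)
  intro i
  rw [map_ι_copowerMap, Functor.comp_map, ← Category.assoc, ← F.map_comp, map_ι_copowerMap,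
    F.map_sum, Preadditive.sum_comp]
  simp only [F.map_smul, Linear.smul_comp, F.map_comp, Category.assoc, map_ι_copowerMap,
    Preadditive.comp_sum, Linear.comp_smul, Finset.smul_sum, smul_smul]
  rw [Finset.sum_comm]
  refine Finset.sum_congr rfl fun j _ => ?_
  rw [← Finset.sum_smul, LinearMap.toMatrix_comp _ (Module.finBasis k V), Matrix.mul_apply]
  congr 1
  exact Finset.sum_congr rfl fun _ _ => mul_comm _ _

theorem copowerMap_natural {V : Type*} [AddCommGroup V] [Module k V] [FiniteDimensional k V]
    {F F' : C ⥤ C} [F.Additive] [F'.Additive] (η : F ⟶ F') (a : V →ₗ[k] V) {Y Z : C}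
    (f : F'.obj Y ⟶ Z) :
    η.app _ ≫ copowerMap F' a f = copowerMap F a (η.app Y ≫ f) := by
  apply map_biproduct_hom_ext F
  intro i
  rw [map_ι_copowerMap, ← Category.assoc, η.naturality, Category.assoc, map_ι_copowerMap]
  simp only [Preadditive.comp_sum, Linear.comp_smul, Category.assoc]

theorem copowerMap_smul {V : Type*} [AddCommGroup V] [Module k V] [FiniteDimensional k V]
    (F : C ⥤ C) [F.Additive] (a : V →ₗ[k] V) {Y Z : C} (f : F.obj Y ⟶ Z) (r r' : k) :
    copowerMap F (r • a) (r' • f) = (r * r') • copowerMap F a f := by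
  apply map_biproduct_hom_ext F
  intro i
  rw [Linear.comp_smul, map_ι_copowerMap, map_ι_copowerMap, Finset.smul_sum]
  refine Finset.sum_congr rfl fun j _ => ?_
  rw [map_smul, Matrix.smul_apply, Linear.smul_comp, smul_smul, smul_smul, smul_eq_mul]
  congr 1
  ring

theorem copowerMap_id {V : Type*} [AddCommGroup V] [Module k V] [FiniteDimensional k V] (Y : C) :
    copowerMap (k := k) (𝟭 C) (LinearMap.id : V →ₗ[k] V) (𝟙 Y) = 𝟙 (copower k V Y) := by
  apply map_biproduct_hom_ext (𝟭 C)
  intro i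
  rw [map_ι_copowerMap, LinearMap.toMatrix_id, Finset.sum_eq_single i]
  · simp
  · intro j _ hj
    rw [Matrix.one_apply_ne hj, zero_smul]
  · simp

namespace LinearAction

/-- The factor set expressed as `c^g ρ^g(c^h) = α̃(g,h)⁻¹ c^{gh} ρ₂^{g,h}`. -/
theorem map_comp_inertiaIso [IsAlgClosed k] (ρ : LinearAction k G C) {Y : C} [Simple Y]
    [FiniteDimensional k (Y ⟶ Y)] (c : ρ.InertiaIsos Y) (g h : ρ.inertia Y) :
    (ρ.F g).map (c h).hom ≫ (c g).hom =
      (ρ.factorSet c g h)⁻¹ • ((ρ.mul g h).hom.app Y ≫ (c (g * h)).hom) := by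
  have h1 := ρ.factorSet_spec c g h
  have h2 : (ρ.mul g h).hom.app Y ≫ (c (g * h)).hom ≫ ρ.obstruction c g h =
      (ρ.F g).map (c h).hom ≫ (c g).hom := by
    rw [obstruction, Iso.hom_inv_id_assoc, Iso.hom_inv_id_app_assoc]
  rw [← h2, ← h1, Linear.comp_smul, Linear.comp_smul, Category.comp_id]

theorem inertiaIso_inv_comp [IsAlgClosed k] (ρ : LinearAction k G C) {Y : C} [Simple Y]
    [FiniteDimensional k (Y ⟶ Y)] (c : ρ.InertiaIsos Y) (g h : ρ.inertia Y) :
    (c g).inv ≫ (ρ.F g).map (c h).inv ≫ (ρ.mul g h).hom.app Y =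
      ρ.factorSet c g h • (c (g * h)).inv := by
  have h1 := ρ.map_comp_inertiaIso c g h
  have h2 : (ρ.mul g h).hom.app Y ≫ (c (g * h)).hom =
      ρ.factorSet c g h • ((ρ.F g).map (c h).hom ≫ (c g).hom) := by
    rw [h1, smul_smul, mul_inv_cancel₀ (ρ.factorSet_ne_zero c g h), one_smul]
  have h3 : (ρ.F g).map (c h).inv ≫ (ρ.F g).map (c h).hom = 𝟙 _ := by
    rw [← Functor.map_comp, Iso.inv_hom_id, CategoryTheory.Functor.map_id]
  rw [← cancel_mono (c (g * h)).hom]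
  simp only [Category.assoc]
  rw [Linear.smul_comp, Iso.inv_hom_id]
  refine (congrArg (fun x => (c g).inv ≫ (ρ.F g).map (c h).inv ≫ x) h2).trans ?_
  rw [Linear.comp_smul, Linear.comp_smul, reassoc_of% h3, Iso.inv_hom_id]

/-- For `c^e`: `c^e ρ_0 = α̃(e,e)⁻¹ id`. -/
theorem one_comp_inertiaIso [IsAlgClosed k] (ρ : LinearAction k G C) {Y : C} [Simple Y]
    [FiniteDimensional k (Y ⟶ Y)] (c : ρ.InertiaIsos Y) :
    ρ.one.hom.app Y ≫ (c 1).hom = (ρ.factorSet c 1 1)⁻¹ • 𝟙 Y := by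
  have h1 := ρ.map_comp_inertiaIso c 1 1
  have h2 : ∀ (g : ρ.inertia Y) (e : 1 = g),
      eqToHom (congrArg (fun g : ρ.inertia Y => (ρ.F g).obj Y) e) ≫ (c g).hom = (c 1).hom := by
    rintro _ rfl
    simp
  have h3 := ρ.one.hom.naturality (c 1).hom
  have h4 := ρ.one_left 1 Y
  have h5 : (c 1).hom ≫ ρ.one.hom.app Y ≫ (c 1).hom = (ρ.factorSet c 1 1)⁻¹ • (c 1).hom := by
    rw [← Category.assoc]
    refine (congrArg (· ≫ (c 1).hom) h3).trans ?_
    refine (Category.assoc _ _ _).trans ?_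
    refine (congrArg (ρ.one.hom.app _ ≫ ·) h1).trans ?_
    refine (Linear.comp_smul _ _ _ _ _ _).trans ?_
    congr 1
    refine (Category.assoc _ _ _).symm.trans ?_
    refine (congrArg (· ≫ (c (1 * 1)).hom) h4).trans ?_
    exact h2 (1 * 1) (one_mul 1).symm
  rw [← cancel_epi (c 1).hom, h5, Linear.comp_smul, Category.comp_id]

/-- The equivariant object `(V_π ⊗ Y, (π(g) ⊗ c^g)_g)` of `C^{G_Y}`. -/
def projRepTensor [IsAlgClosed k] (ρ : LinearAction k G C) {Y : C} [Simple Y]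
    [FiniteDimensional k (Y ⟶ Y)] (c : ρ.InertiaIsos Y) {V : Type*} [AddCommGroup V] [Module k V]
    [FiniteDimensional k V] (π : ProjRep (ρ.factorSet c) V) :
    EquivariantObject (ρ.restrict (ρ.inertia Y)) where
  obj := copower k V Y
  act g := copowerMap (ρ.F g) (π.toFun g).toLinearMap (c g).hom
  act_mul g h := by
    refine (copowerMap_comp (ρ.F g) (ρ.F h) _ _ _ _).trans ?_
    rw [π.mul, map_comp_inertiaIso, copowerMap_smul, mul_inv_cancel₀ (ρ.factorSet_ne_zero c g h),
      one_smul]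
    exact (copowerMap_natural (ρ.mul g h).hom _ _).symm
  act_one := by
    refine (copowerMap_natural ρ.one.hom _ _).trans ?_
    have h1 : (π.toFun 1).toLinearMap = ρ.factorSet c 1 1 • LinearMap.id := by
      have := π.mul 1 1
      rw [mul_one] at this
      ext v
      obtain ⟨w, rfl⟩ := (π.toFun 1).surjective v
      exact LinearMap.congr_fun this w
    erw [one_comp_inertiaIso, h1]
    rw [copowerMap_smul, mul_inv_cancel₀ (ρ.factorSet_ne_zero c 1 1), one_smul]
    exact copowerMap_id Y

/-- The component `ρ^s(ν) (ρ₂^{s,h})⁻¹ ρ₂^{g,t} : ρ^g ρ^t(N) → ρ^s(N)` attached to `gt = sh` and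
`ν : ρ^h(N) → N`. -/
def component (ρ : LinearAction k G C) {N : C} {g t s h : G} (e : s * h = g * t)
    (ν : (ρ.F h).obj N ⟶ N) : (ρ.F g).obj ((ρ.F t).obj N) ⟶ (ρ.F s).obj N :=
  (ρ.mul g t).hom.app N ≫ (ρ.mulIso e).inv.app N ≫ (ρ.F s).map ν

theorem component_comp (ρ : LinearAction k G C) {N : C} {a b t t' t'' h h' : G}
    (e : t' * h = b * t) (e' : t'' * h' = a * t') (e'' : t'' * (h' * h) = a * b * t)
    (ν : (ρ.F h).obj N ⟶ N) (ν' : (ρ.F h').obj N ⟶ N) (ν'' : (ρ.F (h' * h)).obj N ⟶ N) (r : k)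
    (hν : (ρ.F h').map ν ≫ ν' = r • ((ρ.mul h' h).hom.app N ≫ ν'')) :
    (ρ.F a).map (ρ.component e ν) ≫ ρ.component e' ν' =
      r • ((ρ.mul a b).hom.app ((ρ.F t).obj N) ≫ ρ.component e'' ν'') := by
  have A1 := ρ.mulIso_assoc (rfl : a * b = a * b) (rfl : b * t = b * t)
    (rfl : a * b * t = a * b * t) (mul_assoc a b t).symm N
  have A2 := ρ.mulIso_assoc (rfl : a * t' = a * t') e
    (show a * t' * h = a * b * t by rw [mul_assoc, e, mul_assoc]) (mul_assoc a b t).symm N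
  have A3 := ρ.mulIso_assoc e' (rfl : h' * h = h' * h)
    (show a * t' * h = a * b * t by rw [mul_assoc, e, mul_assoc]) e'' N
  have B : (ρ.F a).map ((ρ.mul b t).hom.app N) ≫ (ρ.F a).map ((ρ.mulIso e).inv.app N) ≫
      (ρ.mul a t').hom.app ((ρ.F h).obj N) ≫ (ρ.mulIso e').inv.app ((ρ.F h).obj N) ≫
        (ρ.F t'').map ((ρ.mul h' h).hom.app N) =
      (ρ.mul a b).hom.app ((ρ.F t).obj N) ≫ (ρ.mul (a * b) t).hom.app N ≫
        (ρ.mulIso e'').inv.app N := by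
    rw [← mulIso_rfl ρ b t, ← mulIso_rfl ρ a t', ← mulIso_rfl ρ h' h, ← mulIso_rfl ρ a b,
      ← mulIso_rfl ρ (a * b) t, ← cancel_mono ((ρ.mulIso e'').hom.app N)]
    simp only [Category.assoc, Iso.inv_hom_id_app]
    have E : (ρ.F a).map ((ρ.mulIso e).inv.app N) ≫ (ρ.F a).map ((ρ.mulIso e).hom.app N) =
        𝟙 _ := by
      rw [← CategoryTheory.Functor.map_comp, Iso.inv_hom_id_app, CategoryTheory.Functor.map_id]
    rw [← A3, Iso.inv_hom_id_app_assoc, A2, reassoc_of% E, ← A1]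
    exact congrArg _ (Category.comp_id _).symm
  have N1 : (ρ.F a).map ((ρ.F t').map ν) ≫ (ρ.mul a t').hom.app N =
      (ρ.mul a t').hom.app _ ≫ (ρ.F (a * t')).map ν := (ρ.mul a t').hom.naturality ν
  have N2 : (ρ.F (a * t')).map ν ≫ (ρ.mulIso e').inv.app N =
      (ρ.mulIso e').inv.app _ ≫ (ρ.F t'').map ((ρ.F h').map ν) :=
    (ρ.mulIso e').inv.naturality ν
  calc
    _ = (ρ.F a).map ((ρ.mul b t).hom.app N) ≫ (ρ.F a).map ((ρ.mulIso e).inv.app N) ≫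
        ((ρ.F a).map ((ρ.F t').map ν) ≫ (ρ.mul a t').hom.app N) ≫
          (ρ.mulIso e').inv.app N ≫ (ρ.F t'').map ν' := by
      simp only [component, Functor.map_comp, Category.assoc]
    _ = (ρ.F a).map ((ρ.mul b t).hom.app N) ≫ (ρ.F a).map ((ρ.mulIso e).inv.app N) ≫
        (ρ.mul a t').hom.app _ ≫ ((ρ.F (a * t')).map ν ≫
          (ρ.mulIso e').inv.app N) ≫ (ρ.F t'').map ν' := by
      rw [N1]
      simp only [Category.assoc]
    _ = (ρ.F a).map ((ρ.mul b t).hom.app N) ≫ (ρ.F a).map ((ρ.mulIso e).inv.app N) ≫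
        (ρ.mul a t').hom.app _ ≫ (ρ.mulIso e').inv.app _ ≫
          (ρ.F t'').map ((ρ.F h').map ν ≫ ν') := by
      rw [N2, Functor.map_comp]
      simp only [Category.assoc]
    _ = r • (((ρ.F a).map ((ρ.mul b t).hom.app N) ≫ (ρ.F a).map ((ρ.mulIso e).inv.app N) ≫
        (ρ.mul a t').hom.app _ ≫ (ρ.mulIso e').inv.app _ ≫
          (ρ.F t'').map ((ρ.mul h' h).hom.app N)) ≫ (ρ.F t'').map ν'') := by
      rw [hν, Functor.map_smul, Functor.map_comp]
      simp only [Linear.comp_smul, Category.assoc]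
    _ = _ := by
      rw [B]
      simp only [component, Category.assoc]

theorem one_component (ρ : LinearAction k G C) {N : C} {t : G} (e : t * 1 = 1 * t)
    (ν : (ρ.F 1).obj N ⟶ N) :
    ρ.one.hom.app ((ρ.F t).obj N) ≫ ρ.component e ν = (ρ.F t).map (ρ.one.hom.app N ≫ ν) := by
  have h1 := ρ.one_left t N
  have h2 := ρ.one_right t N
  have h3 : (ρ.F t).map (ρ.one.hom.app N) ≫ (ρ.mulIso e).hom.app N =
      ρ.one.hom.app ((ρ.F t).obj N) ≫ (ρ.mul 1 t).hom.app N := by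
    rw [h1, mulIso, Iso.trans_hom, NatTrans.comp_app, eqToIso.hom, eqToHom_app]
    refine (Category.assoc _ _ _).symm.trans ?_
    refine (congrArg (· ≫ eqToHom _) h2).trans ?_
    exact eqToHom_trans _ _
  rw [component, ← Category.assoc, ← h3, Category.assoc, Iso.hom_inv_id_app_assoc,
    ← Functor.map_comp]

/-- The element `h ∈ H` with `g R(q) = R(gq) h`. -/
def cosetElement {H : Subgroup G} (R : G ⧸ H → G) (hR : ∀ q, (R q : G ⧸ H) = q) (g : G)
    (q : G ⧸ H) : H :=
  ⟨(R (g • q))⁻¹ * (g * R q), by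
    rw [← QuotientGroup.eq, hR]
    conv_lhs => rw [← hR q]
    rfl⟩

theorem cosetElement_spec {H : Subgroup G} (R : G ⧸ H → G) (hR : ∀ q, (R q : G ⧸ H) = q) (g : G)
    (q : G ⧸ H) : R (g • q) * (cosetElement R hR g q : G) = g * R q := by
  simp [cosetElement]

theorem component_ι [Finite G] (ρ : LinearAction k G C) {H : Subgroup G} (R : G ⧸ H → G)
    (N : EquivariantObject (ρ.restrict H)) {g t : G} {q q' : G ⧸ H} (hq : q = q') {h h' : H}
    (e : R q * h = g * t) (e' : R q' * h' = g * t) :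
    ρ.component e (N.act h) ≫ biproduct.ι (fun q => (ρ.F (R q)).obj N.obj) q =
      ρ.component e' (N.act h') ≫ biproduct.ι (fun q => (ρ.F (R q)).obj N.obj) q' := by
  subst hq
  obtain rfl : h = h' := Subtype.ext (mul_left_cancel (e.trans e'.symm))
  rfl

/-- The induced equivariant object `L^R(N, ν) = (⨁_{t ∈ R} ρ^t(N), μ)` of `C^G` attached to an
`H`-equivariant object `(N, ν)` and a set `R` of representatives of the left cosets of `H`, given
as a section of `G → G ⧸ H`. The component `ρ^g ρ^t(N) → ρ^s(N)` of `μ^g`, where `gt = sh` with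
`s ∈ R` and `h ∈ H`, is `ρ^s(ν^h) (ρ₂^{s,h})⁻¹ ρ₂^{g,t}`. -/
def induction [Finite G] (ρ : LinearAction k G C) {H : Subgroup G} (R : G ⧸ H → G)
    (hR : ∀ q, (R q : G ⧸ H) = q) (N : EquivariantObject (ρ.restrict H)) :
    EquivariantObject ρ where
  obj := ⨁ fun q => (ρ.F (R q)).obj N.obj
  act g := mapDesc (ρ.F g) _ fun q =>
    ρ.component (cosetElement_spec R hR g q) (N.act (cosetElement R hR g q)) ≫
      biproduct.ι (fun q => (ρ.F (R q)).obj N.obj) (g • q)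
  act_mul a b := by
    apply map_biproduct_hom_ext (ρ.F b ⋙ ρ.F a)
    intro q
    have e'' : R (a • b • q) * ((cosetElement R hR a (b • q) * cosetElement R hR b q : H) : G) =
        a * b * R q := by
      rw [Subgroup.coe_mul, ← mul_assoc, cosetElement_spec, mul_assoc, cosetElement_spec,
        mul_assoc]
    have K := ρ.component_comp (cosetElement_spec R hR b q) (cosetElement_spec R hR a (b • q)) e''
      (N.act (cosetElement R hR b q)) (N.act (cosetElement R hR a (b • q)))
      (N.act (cosetElement R hR a (b • q) * cosetElement R hR b q)) 1
      (by rw [one_smul]; exact N.act_mul _ _)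
    rw [one_smul] at K
    have nat : ((ρ.F b ⋙ ρ.F a).map (biproduct.ι (fun q => (ρ.F (R q)).obj N.obj) q)) ≫
        (ρ.mul a b).hom.app (⨁ fun q => (ρ.F (R q)).obj N.obj) =
          (ρ.mul a b).hom.app _ ≫
            (ρ.F (a * b)).map (biproduct.ι (fun q => (ρ.F (R q)).obj N.obj) q) :=
      (ρ.mul a b).hom.naturality _
    refine Eq.trans ?_ (((Category.assoc _ _ _).symm.trans (congrArg (· ≫ _) nat)).trans
      (Category.assoc _ _ _)).symm
    rw [map_ι_mapDesc]
    change (ρ.F a).map ((ρ.F b).map _) ≫ _ ≫ _ = _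
    refine (Functor.map_comp_assoc (ρ.F a) _ _ _).symm.trans ?_
    rw [map_ι_mapDesc, Functor.map_comp, Category.assoc, map_ι_mapDesc]
    refine ((Category.assoc _ _ _).symm.trans (congrArg (· ≫ _) K)).trans ?_
    refine (Category.assoc _ _ _).trans (congrArg (_ ≫ ·) ?_)
    exact ρ.component_ι R N (mul_smul a b q).symm e'' (cosetElement_spec R hR (a * b) q)
  act_one := by
    apply biproduct.hom_ext'
    intro q
    have nat : biproduct.ι (fun q => (ρ.F (R q)).obj N.obj) q ≫
        ρ.one.hom.app (⨁ fun q => (ρ.F (R q)).obj N.obj) =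
          ρ.one.hom.app _ ≫
            (ρ.F 1).map (biproduct.ι (fun q => (ρ.F (R q)).obj N.obj) q) :=
      ρ.one.hom.naturality _
    have e : R q * ((1 : H) : G) = 1 * R q := by simp
    rw [reassoc_of% nat, map_ι_mapDesc, ρ.component_ι R N (one_smul G q)
      (cosetElement_spec R hR 1 q) e, ← Category.assoc]
    have K : ρ.one.hom.app ((ρ.F (R q)).obj N.obj) ≫ ρ.component e (N.act 1) = 𝟙 _ := by
      refine (ρ.one_component e (N.act 1)).trans ?_
      refine (congrArg (ρ.F (R q)).map N.act_one).trans ?_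
      exact (ρ.F (R q)).map_id _
    rw [K, Category.comp_id]
    exact Category.id_comp _

/-- The object `S_{Y,π} = L^R(V_π ⊗ Y)` of `C^G`. -/
def simpleObject [Finite G] [IsAlgClosed k] (ρ : LinearAction k G C) {Y : C} [Simple Y]
    [FiniteDimensional k (Y ⟶ Y)] (c : ρ.InertiaIsos Y) (R : G ⧸ ρ.inertia Y → G)
    (hR : ∀ q, (R q : G ⧸ ρ.inertia Y) = q) {V : Type*} [AddCommGroup V] [Module k V]
    [FiniteDimensional k V] (π : ProjRep (ρ.factorSet c) V) : EquivariantObject ρ :=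
  ρ.induction R hR (ρ.projRepTensor c π)

/-- The conjugate isomorphisms
`(ᵗc)^g = ρ^t(c^{t⁻¹gt}) (ρ₂^{t,t⁻¹gt})⁻¹ ρ₂^{g,t} : ρ^g(ρ^t(Y)) → ρ^t(Y)` for `g ∈ tG_Yt⁻¹`. -/
def conjIso (ρ : LinearAction k G C) {Y : C} (c : ρ.InertiaIsos Y) (t : G)
    (g : conj t (ρ.inertia Y)) : (ρ.F g).obj ((ρ.F t).obj Y) ≅ (ρ.F t).obj Y :=
  (ρ.mul g t).app Y ≪≫
    ((ρ.mulIso (show t * (t⁻¹ * g * t) = g * t by group)).app Y).symm ≪≫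
      (ρ.F t).mapIso (c (conjHom t _ g))

theorem conjIso_comp [IsAlgClosed k] (ρ : LinearAction k G C) {Y : C} [Simple Y]
    [FiniteDimensional k (Y ⟶ Y)] (c : ρ.InertiaIsos Y) (t : G) (g h : conj t (ρ.inertia Y)) :
    (ρ.F g).map (ρ.conjIso c t h).hom ≫ (ρ.conjIso c t g).hom =
      (ρ.factorSet c (conjHom t _ g) (conjHom t _ h))⁻¹ •
        ((ρ.mul g h).hom.app _ ≫ (ρ.conjIso c t (g * h)).hom) := by
  have key : ∀ (x y : ρ.inertia Y) (a : G) (e : t * (x : G) = a * t) (e' : t * (y : G) = a * t),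
      x = y → ρ.component e (c x).hom = ρ.component e' (c y).hom := by
    rintro x _ a e e' rfl
    rfl
  have e'' : t * ((conjHom t _ g * conjHom t _ h : ρ.inertia Y) : G) = (g * h : G) * t := by
    simp [conjHom, mul_assoc]
  refine (ρ.component_comp (show t * (t⁻¹ * h * t) = h * t by group)
    (show t * (t⁻¹ * g * t) = g * t by group) e'' (c (conjHom t _ h)).hom (c (conjHom t _ g)).hom
    (c (conjHom t _ g * conjHom t _ h)).hom _
    (ρ.map_comp_inertiaIso c (conjHom t _ g) (conjHom t _ h))).trans ?_
  congr 2
  exact key _ _ _ e'' (show t * (t⁻¹ * (g * h : G) * t) = (g * h : G) * t by group)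
    (map_mul (conjHom t _) g h).symm

end LinearAction

end Linear

namespace TensorAction

open LinearAction

variable {k : Type*} [Field k] {G : Type*} [Group G] {C : Type u} [Category.{v} C]
  [Abelian C] [Linear k C] [MonoidalCategory C]

theorem map_δ_comp_δ (ρ : TensorAction k G C) (g h : G) (X Y : C) :
    (ρ.F g).map (Functor.OplaxMonoidal.δ (ρ.F h) X Y) ≫
      Functor.OplaxMonoidal.δ (ρ.F g) ((ρ.F h).obj X) ((ρ.F h).obj Y) ≫
        ((ρ.mul g h).hom.app X ⊗ₘ (ρ.mul g h).hom.app Y) =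
      (ρ.mul g h).hom.app (X ⊗ Y) ≫ Functor.OplaxMonoidal.δ (ρ.F (g * h)) X Y := by
  have h1 := NatTrans.IsMonoidal.tensor (τ := (ρ.mul g h).hom) X Y
  rw [← cancel_mono (Functor.LaxMonoidal.μ (ρ.F (g * h)) X Y),
    ← cancel_epi (Functor.LaxMonoidal.μ (ρ.F h ⋙ ρ.F g) X Y)]
  simp only [Category.assoc, Functor.Monoidal.δ_μ, Category.comp_id]
  rw [h1, Functor.LaxMonoidal.comp_μ, Category.assoc, ← Functor.map_comp_assoc,
    Functor.Monoidal.μ_δ, CategoryTheory.Functor.map_id, Category.id_comp, Functor.Monoidal.μ_δ_assoc]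

theorem one_comp_δ (ρ : TensorAction k G C) (X Y : C) :
    ρ.one.hom.app (X ⊗ Y) ≫ Functor.OplaxMonoidal.δ (ρ.F 1) X Y =
      (ρ.one.hom.app X ⊗ₘ ρ.one.hom.app Y) := by
  have h1 := NatTrans.IsMonoidal.tensor (τ := ρ.one.hom) X Y
  rw [← cancel_mono (Functor.LaxMonoidal.μ (ρ.F 1) X Y), Category.assoc, Functor.Monoidal.δ_μ,
    Category.comp_id, ← h1]
  simp

/-- The tensor product `(X, μ_X) ⊗ (Y, μ_Y) = (X ⊗ Y, (μ_X ⊗ μ_Y) ρ_{2,X,Y})` of `C^G`. -/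
def tensorObj (ρ : TensorAction k G C) (X Y : EquivariantObject ρ.toLinearAction) :
    EquivariantObject ρ.toLinearAction where
  obj := X.obj ⊗ Y.obj
  act g := Functor.OplaxMonoidal.δ (ρ.F g) X.obj Y.obj ≫ (X.act g ⊗ₘ Y.act g)
  act_mul g h := by
    rw [Functor.map_comp, Category.assoc, ← Functor.OplaxMonoidal.δ_natural_assoc,
      tensorHom_comp_tensorHom, X.act_mul, Y.act_mul, ← tensorHom_comp_tensorHom,
      reassoc_of% map_δ_comp_δ]
  act_one := by
    rw [reassoc_of% one_comp_δ, tensorHom_comp_tensorHom, X.act_one, Y.act_one, id_tensorHom_id]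

/-- The group `T = G_U ∩ tG_Yt⁻¹ ∩ sG_Zs⁻¹`. -/
def fusionStabilizer (ρ : TensorAction k G C) (U Y Z : C) (t s : G) : Subgroup G :=
  ρ.inertia U ⊓ conj t (ρ.inertia Y) ⊓ conj s (ρ.inertia Z)

section

variable (ρ : TensorAction k G C) (U Y Z : C) (t s : G)

/-- The inclusion `T → G_U`. -/
def toInertia : ρ.fusionStabilizer U Y Z t s →* ρ.inertia U :=
  Subgroup.inclusion (inf_le_left.trans inf_le_left)

/-- The inclusion `T → tG_Yt⁻¹`. -/
def toConjLeft : ρ.fusionStabilizer U Y Z t s →* conj t (ρ.inertia Y) :=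
  Subgroup.inclusion (inf_le_left.trans inf_le_right)

/-- The inclusion `T → sG_Zs⁻¹`. -/
def toConjRight : ρ.fusionStabilizer U Y Z t s →* conj s (ρ.inertia Z) :=
  Subgroup.inclusion inf_le_right

end

/-- The action of `g ∈ T` on `Hom_C(U, ρ^t(Y) ⊗ ρ^s(Z))`:
`g · f = ((ᵗc_Y)^g ⊗ (ˢc_Z)^g) (ρ₂^g)_{ρ^t(Y),ρ^s(Z)} ρ^g(f) (c_U^g)⁻¹`. -/
def tauMap (ρ : TensorAction k G C) {U Y Z : C} (cU : ρ.InertiaIsos U) (cY : ρ.InertiaIsos Y)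
    (cZ : ρ.InertiaIsos Z) (t s : G) (g : ρ.fusionStabilizer U Y Z t s) :
    (U ⟶ (ρ.F t).obj Y ⊗ (ρ.F s).obj Z) →ₗ[k] (U ⟶ (ρ.F t).obj Y ⊗ (ρ.F s).obj Z) :=
  Linear.leftComp k _ (cU (ρ.toInertia U Y Z t s g)).inv ∘ₗ
    Linear.rightComp k _ (Functor.OplaxMonoidal.δ (ρ.F g) ((ρ.F t).obj Y) ((ρ.F s).obj Z) ≫
      ((ρ.conjIso cY t (ρ.toConjLeft U Y Z t s g)).hom ⊗ₘ
        (ρ.conjIso cZ s (ρ.toConjRight U Y Z t s g)).hom)) ∘ₗ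
    (ρ.F g).mapLinearMap k

theorem tauMap_apply (ρ : TensorAction k G C) {U Y Z : C} (cU : ρ.InertiaIsos U)
    (cY : ρ.InertiaIsos Y) (cZ : ρ.InertiaIsos Z) (t s : G) (g : ρ.fusionStabilizer U Y Z t s)
    (f : U ⟶ (ρ.F t).obj Y ⊗ (ρ.F s).obj Z) :
    ρ.tauMap cU cY cZ t s g f = (cU (ρ.toInertia U Y Z t s g)).inv ≫ (ρ.F g).map f ≫
      Functor.OplaxMonoidal.δ (ρ.F g) ((ρ.F t).obj Y) ((ρ.F s).obj Z) ≫
      ((ρ.conjIso cY t (ρ.toConjLeft U Y Z t s g)).hom ⊗ₘ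
        (ρ.conjIso cZ s (ρ.toConjRight U Y Z t s g)).hom) := rfl

theorem tauMap_one_bijective (ρ : TensorAction k G C) {U Y Z : C} (cU : ρ.InertiaIsos U)
    (cY : ρ.InertiaIsos Y) (cZ : ρ.InertiaIsos Z) (t s : G) :
    Function.Bijective (ρ.tauMap cU cY cZ t s 1) := by
  have h : ∀ f, ρ.tauMap cU cY cZ t s 1 f =
      Iso.homCongr ((ρ.one.app U) ≪≫ cU 1)
        ((ρ.one.app _) ≪≫ (Functor.Monoidal.μIso (ρ.F 1) ((ρ.F t).obj Y) ((ρ.F s).obj Z)).symm ≪≫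
          (ρ.conjIso cY t 1 ⊗ᵢ ρ.conjIso cZ s 1)) f := by
    intro f
    have n1 := ρ.one.hom.naturality f
    simp only [CategoryTheory.Functor.id_map] at n1
    simp only [Iso.homCongr_apply, Iso.trans_inv, Iso.trans_hom, Category.assoc, Iso.app_hom,
      Iso.app_inv, Iso.symm_hom, Functor.Monoidal.μIso_inv, tensorIso_hom]
    rw [reassoc_of% n1, Iso.inv_hom_id_app_assoc]
    rfl
  rw [funext h]
  exact Equiv.bijective _

variable [MonoidalPreadditive C] [MonoidalLinear k C]

theorem tau_comp_aux (ρ : TensorAction k G C) (g h : G) {U X X' : C}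
    (cg : U ⟶ (ρ.F g).obj U) (ch : U ⟶ (ρ.F h).obj U) (cgh : U ⟶ (ρ.F (g * h)).obj U)
    (ag : (ρ.F g).obj X ⟶ X) (ah : (ρ.F h).obj X ⟶ X) (agh : (ρ.F (g * h)).obj X ⟶ X)
    (bg : (ρ.F g).obj X' ⟶ X') (bh : (ρ.F h).obj X' ⟶ X') (bgh : (ρ.F (g * h)).obj X' ⟶ X')
    (ru ra rb : k)
    (hc : cg ≫ (ρ.F g).map ch ≫ (ρ.mul g h).hom.app U = ru • cgh)
    (ha : (ρ.F g).map ah ≫ ag = ra • ((ρ.mul g h).hom.app X ≫ agh))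
    (hb : (ρ.F g).map bh ≫ bg = rb • ((ρ.mul g h).hom.app X' ≫ bgh)) (f : U ⟶ X ⊗ X') :
    cg ≫ (ρ.F g).map (ch ≫ (ρ.F h).map f ≫ Functor.OplaxMonoidal.δ (ρ.F h) X X' ≫ (ah ⊗ₘ bh)) ≫
        Functor.OplaxMonoidal.δ (ρ.F g) X X' ≫ (ag ⊗ₘ bg) =
      (ru * ra * rb) • (cgh ≫ (ρ.F (g * h)).map f ≫
        Functor.OplaxMonoidal.δ (ρ.F (g * h)) X X' ≫ (agh ⊗ₘ bgh)) := by
  have hf : (ρ.F g).map ((ρ.F h).map f) ≫ (ρ.mul g h).hom.app _ =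
    (ρ.mul g h).hom.app U ≫ (ρ.F (g * h)).map f := (ρ.mul g h).hom.naturality f
  have hsmul : ∀ {P P' Q Q' : C} (x : P ⟶ P') (y : Q ⟶ Q') (a b : k),
      (a • x ⊗ₘ b • y) = (a * b) • (x ⊗ₘ y) := by
    intro P P' Q Q' x y a b
    rw [MonoidalCategory.tensorHom_def, MonoidalCategory.tensorHom_def, MonoidalLinear.smul_whiskerRight,
      MonoidalLinear.whiskerLeft_smul, Linear.smul_comp, Linear.comp_smul, smul_smul]
  have h1 : (ρ.F g).map (ah ⊗ₘ bh) ≫ Functor.OplaxMonoidal.δ (ρ.F g) X X' ≫ (ag ⊗ₘ bg) =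
      (ra * rb) • (Functor.OplaxMonoidal.δ (ρ.F g) ((ρ.F h).obj X) ((ρ.F h).obj X') ≫
        ((ρ.mul g h).hom.app X ⊗ₘ (ρ.mul g h).hom.app X') ≫ (agh ⊗ₘ bgh)) := by
    rw [← Functor.OplaxMonoidal.δ_natural_assoc, tensorHom_comp_tensorHom, ha, hb, hsmul,
      ← tensorHom_comp_tensorHom, Linear.comp_smul]
  simp only [Functor.map_comp, Category.assoc]
  rw [h1]
  simp only [Linear.comp_smul]
  rw [reassoc_of% map_δ_comp_δ, reassoc_of% hf, reassoc_of% hc, Linear.smul_comp, smul_smul]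
  congr 1
  ring

theorem tauMap_comp [IsAlgClosed k] (ρ : TensorAction k G C) {U Y Z : C} [Simple U] [Simple Y]
    [Simple Z] [FiniteDimensional k (U ⟶ U)] [FiniteDimensional k (Y ⟶ Y)]
    [FiniteDimensional k (Z ⟶ Z)] (cU : ρ.InertiaIsos U)
    (cY : ρ.InertiaIsos Y) (cZ : ρ.InertiaIsos Z) (t s : G) (g h : ρ.fusionStabilizer U Y Z t s) :
    ρ.tauMap cU cY cZ t s g ∘ₗ ρ.tauMap cU cY cZ t s h =
      (ρ.factorSet cU (ρ.toInertia U Y Z t s g) (ρ.toInertia U Y Z t s h) *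
      (ρ.factorSet cY (conjHom t _ (ρ.toConjLeft U Y Z t s g))
        (conjHom t _ (ρ.toConjLeft U Y Z t s h)))⁻¹ *
      (ρ.factorSet cZ (conjHom s _ (ρ.toConjRight U Y Z t s g))
        (conjHom s _ (ρ.toConjRight U Y Z t s h)))⁻¹) • ρ.tauMap cU cY cZ t s (g * h) := by
  ext f
  simp only [LinearMap.comp_apply, LinearMap.smul_apply, tauMap_apply]
  exact ρ.tau_comp_aux g h _ _ _ _ _ _ _ _ _ _ _ _
    (ρ.inertiaIso_inv_comp cU (ρ.toInertia U Y Z t s g) (ρ.toInertia U Y Z t s h))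
    (ρ.conjIso_comp cY t (ρ.toConjLeft U Y Z t s g) (ρ.toConjLeft U Y Z t s h))
    (ρ.conjIso_comp cZ s (ρ.toConjRight U Y Z t s g) (ρ.toConjRight U Y Z t s h)) f

/-- The projective representation `τ_U^{t,s}(Y,Z)` of `T` on `Hom_C(U, ρ^t(Y) ⊗ ρ^s(Z))`. -/
def tau [IsAlgClosed k] (ρ : TensorAction k G C) {U Y Z : C} [Simple U] [Simple Y] [Simple Z]
    [FiniteDimensional k (U ⟶ U)] [FiniteDimensional k (Y ⟶ Y)] [FiniteDimensional k (Z ⟶ Z)]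
    (cU : ρ.InertiaIsos U) (cY : ρ.InertiaIsos Y) (cZ : ρ.InertiaIsos Z) (t s : G) :
    ProjRep (G := ρ.fusionStabilizer U Y Z t s) (fun g h : ρ.fusionStabilizer U Y Z t s =>
      ρ.factorSet cU (ρ.toInertia U Y Z t s g) (ρ.toInertia U Y Z t s h) *
      (ρ.factorSet cY (conjHom t _ (ρ.toConjLeft U Y Z t s g))
        (conjHom t _ (ρ.toConjLeft U Y Z t s h)))⁻¹ *
      (ρ.factorSet cZ (conjHom s _ (ρ.toConjRight U Y Z t s g))
        (conjHom s _ (ρ.toConjRight U Y Z t s h)))⁻¹)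
      (U ⟶ (ρ.F t).obj Y ⊗ (ρ.F s).obj Z) :=
  ProjRep.ofLinearMap _ (ρ.tauMap cU cY cZ t s)
    (fun _ _ => mul_ne_zero (mul_ne_zero (ρ.factorSet_ne_zero _ _ _)
      (inv_ne_zero (ρ.factorSet_ne_zero _ _ _))) (inv_ne_zero (ρ.factorSet_ne_zero _ _ _)))
    (ρ.tauMap_one_bijective cU cY cZ t s) (ρ.tauMap_comp cU cY cZ t s)

end TensorAction

end

/-! Since `δ` is irreducible, S_{U,δ} is simple (`simple_simpleObject`). A nonzero morphism out of a
simple object is mono, so S_{U,δ} is a constituent of X = S_{Y,π} ⊗ S_{Z,γ} exactly when there is a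
nonzero morphism S_{U,δ} → X (`isConstituent_iff`).

S_{U,δ} is induced from G_U. Frobenius reciprocity, together with Hom_C(V ⊗ U, X) = Hom_k(V,
Hom_C(U, X)), turns such morphisms into linear maps V_δ → Hom_C(U, X) that intertwine `δ` with the
operators f ↦ μ^g ρ^g(f) (c_U^g)⁻¹. These operators multiply with factor set α̃_U (`homAct_comp`,
`exists_simpleObject_hom_ne_zero_iff`).

The rest is Mackey theory. Hom_C(U, X) is the direct sum of blocks V_π ⊗ V_γ ⊗ Hom_C(U, ρ^t(Y) ⊗
ρ^s(Z)), one for each pair of cosets (`fusionπ_fusionι`, `sum_fusionι_fusionπ`). G_U permutes the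
blocks as it permutes the pairs of cosets. The stabiliser of a pair is T, and T acts on the block by
ᵗπ ⊗ ˢγ ⊗ τ (`tensorHomAct_fusionι`). A nonzero G_U-intertwiner has a nonzero component in some
block, and that component commutes with T. Conversely, a T-intertwiner into a block can be averaged
over G_U. The component of the average in that block is |T| times the original map, hence nonzero in
characteristic zero (`exists_intertwiner_tensorHomAct_iff`). This gives condition (b), and (b)
implies (a), because a block with zero Hom space receives no nonzero map. -/

set_option linter.unusedSectionVars false

noncomputable section

/-! ### Coherence of the action, componentwise. -/

namespace LinearAction

variable {k : Type*} [Field k] {G : Type*} [Group G] {C : Type u} [Category.{v} C]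
  [Preadditive C] [Linear k C] (ρ : LinearAction k G C)

/-- The component at `X` of the structure isomorphism `ρ^g ρ^h ≅ ρ^l` when `gh = l`. -/
def mulApp {g h l : G} (e : g * h = l) (X : C) : (ρ.F g).obj ((ρ.F h).obj X) ≅ (ρ.F l).obj X :=
  (ρ.mulIso e).app X

/-- The component at `X` of the unit isomorphism. -/
def oneApp (X : C) : X ≅ (ρ.F 1).obj X := ρ.one.app X

/-- Passage to a normal form: in `mulApp` the target index is a variable tied to the product by an
equation, so associativity can be applied without transports between `ρ^{(ab)c}` and `ρ^{a(bc)}`. -/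
theorem mul_hom_app (g h : G) (X : C) :
    (ρ.mul g h).hom.app X = (ρ.mulApp (rfl : g * h = g * h) X).hom := by
  rw [← mulIso_rfl]
  rfl

theorem mulIso_inv_app {g h l : G} (e : g * h = l) (X : C) :
    (ρ.mulIso e).inv.app X = (ρ.mulApp e X).inv := rfl

theorem one_hom_app (X : C) : ρ.one.hom.app X = (ρ.oneApp X).hom := rfl

theorem mulApp_naturality {g h l : G} (e : g * h = l) {X Y : C} (f : X ⟶ Y) :
    (ρ.F g).map ((ρ.F h).map f) ≫ (ρ.mulApp e Y).hom = (ρ.mulApp e X).hom ≫ (ρ.F l).map f :=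
  (ρ.mulIso e).hom.naturality f

theorem mulApp_inv_naturality {g h l : G} (e : g * h = l) {X Y : C} (f : X ⟶ Y) :
    (ρ.F l).map f ≫ (ρ.mulApp e Y).inv = (ρ.mulApp e X).inv ≫ (ρ.F g).map ((ρ.F h).map f) :=
  (ρ.mulIso e).inv.naturality f

theorem oneApp_naturality {X Y : C} (f : X ⟶ Y) :
    f ≫ (ρ.oneApp Y).hom = (ρ.oneApp X).hom ≫ (ρ.F 1).map f :=
  ρ.one.hom.naturality f

theorem mulApp_assoc {a b c ab bc abc : G} (h1 : a * b = ab)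
    (h2 : b * c = bc) (h3 : ab * c = abc) (h4 : a * bc = abc) (X : C) :
    (ρ.mulApp h1 ((ρ.F c).obj X)).hom ≫ (ρ.mulApp h3 X).hom =
      (ρ.F a).map (ρ.mulApp h2 X).hom ≫ (ρ.mulApp h4 X).hom :=
  ρ.mulIso_assoc h1 h2 h3 h4 X

theorem map_mulApp_inv_comp {a b c ab bc abc : G} (h1 : a * b = ab)
    (h2 : b * c = bc) (h3 : ab * c = abc) (h4 : a * bc = abc) (X : C) :
    (ρ.F a).map (ρ.mulApp h2 X).inv ≫ (ρ.mulApp h1 ((ρ.F c).obj X)).hom =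
      (ρ.mulApp h4 X).hom ≫ (ρ.mulApp h3 X).inv := by
  rw [Iso.eq_comp_inv, Category.assoc, mulApp_assoc ρ h1 h2 h3 h4, ← Category.assoc,
    ← Functor.map_comp, Iso.inv_hom_id, CategoryTheory.Functor.map_id, Category.id_comp]

theorem oneApp_mulApp {a : G} (e : 1 * a = a) (X : C) :
    (ρ.oneApp ((ρ.F a).obj X)).hom ≫ (ρ.mulApp e X).hom = 𝟙 _ := by
  have h := ρ.one_left a X
  simp only [mulApp, oneApp, mulIso, Iso.app_hom, Iso.trans_hom, eqToIso.hom, NatTrans.comp_app,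
    eqToHom_app] at h ⊢
  rw [reassoc_of% h, eqToHom_trans]
  rfl

theorem map_oneApp_mulApp {a : G} (e : a * 1 = a) (X : C) :
    (ρ.F a).map (ρ.oneApp X).hom ≫ (ρ.mulApp e X).hom = 𝟙 _ := by
  have h := ρ.one_right a X
  simp only [mulApp, oneApp, mulIso, Iso.app_hom, Iso.trans_hom, eqToIso.hom, NatTrans.comp_app,
    eqToHom_app] at h ⊢
  rw [reassoc_of% h, eqToHom_trans]
  rfl

/-- Each `ρ^g` is an equivalence. -/
def equivalence (g : G) : C ≌ C :=
  CategoryTheory.Equivalence.mk (ρ.F g) (ρ.F g⁻¹)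
    (ρ.one ≪≫ (ρ.mulIso (inv_mul_cancel g)).symm)
    (ρ.mulIso (mul_inv_cancel g) ≪≫ ρ.one.symm)

/-- Needed for two consequences: `ρ^g` preserves simple objects, and it is full. -/
instance (g : G) : (ρ.F g).IsEquivalence :=
  (ρ.equivalence g).isEquivalence_functor

end LinearAction

/-! ### Kernels, monomorphisms and constituents in the equivariantization. -/

namespace EquivariantObject

variable {k : Type*} [Field k] {G : Type*} [Group G] {C : Type u} [Category.{v} C]
  [Abelian C] [Linear k C] {ρ : LinearAction k G C}

open LinearAction

theorem act_mulApp (X : EquivariantObject ρ) {g h l : G} (e : g * h = l) :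
    (ρ.F g).map (X.act h) ≫ X.act g = (ρ.mulApp e X.obj).hom ≫ X.act l :=
  X.act_mulIso e

theorem oneApp_act (X : EquivariantObject ρ) : (ρ.oneApp X.obj).hom ≫ X.act 1 = 𝟙 _ :=
  X.act_one

@[simp]
theorem comp_hom {X Y Z : EquivariantObject ρ} (f : X ⟶ Y) (g : Y ⟶ Z) :
    (f ≫ g).hom = f.hom ≫ g.hom := rfl

@[simp]
theorem zero_hom (X Y : EquivariantObject ρ) : (0 : X ⟶ Y).hom = 0 := rfl

theorem hom_ext {X Y : EquivariantObject ρ} {f g : X ⟶ Y} (h : f.hom = g.hom) : f = g :=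
  Hom.ext h

theorem hom_comm {X Y : EquivariantObject ρ} (f : X ⟶ Y) (g : G) :
    X.act g ≫ f.hom = (ρ.F g).map f.hom ≫ Y.act g :=
  f.comm g

/-- The kernel of a morphism of equivariant objects. -/
def kernelObj {X Y : EquivariantObject ρ} (f : X ⟶ Y) : EquivariantObject ρ where
  obj := kernel f.hom
  -- Lifting into the kernel only requires a map killed by `f`, so exactness of `ρ^g` plays no role.
  act g := kernel.lift f.hom ((ρ.F g).map (kernel.ι f.hom) ≫ X.act g) (by
    rw [Category.assoc, hom_comm, ← Functor.map_comp_assoc, kernel.condition, Functor.map_zero,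
      zero_comp])
  act_mul g h := by
    rw [← cancel_mono (kernel.ι f.hom), mul_hom_app]
    simp only [Category.assoc, kernel.lift_ι]
    rw [← Functor.map_comp_assoc, kernel.lift_ι, Functor.map_comp, Category.assoc,
      X.act_mulApp rfl, reassoc_of% ρ.mulApp_naturality]
  act_one := by
    rw [← cancel_mono (kernel.ι f.hom), one_hom_app]
    simp only [Category.assoc, kernel.lift_ι]
    rw [← reassoc_of% ρ.oneApp_naturality (kernel.ι f.hom), oneApp_act, Category.comp_id]
    exact (Category.id_comp _).symm

/-- The inclusion of the kernel of a morphism of equivariant objects. -/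
def kernelι {X Y : EquivariantObject ρ} (f : X ⟶ Y) : kernelObj f ⟶ X where
  hom := kernel.ι f.hom
  comm _ := kernel.lift_ι _ _ _

theorem kernelι_comp {X Y : EquivariantObject ρ} (f : X ⟶ Y) : kernelι f ≫ f = 0 :=
  hom_ext (kernel.condition f.hom)

theorem mono_of_mono_hom {X Y : EquivariantObject ρ} (f : X ⟶ Y) [Mono f.hom] : Mono f :=
  ⟨fun _ _ h => hom_ext ((cancel_mono f.hom).1 (congrArg Hom.hom h))⟩

instance {X Y : EquivariantObject ρ} (f : X ⟶ Y) : Mono (kernelι f) := by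
  have : Mono (kernelι f).hom := inferInstanceAs (Mono (kernel.ι f.hom))
  exact mono_of_mono_hom _

theorem mono_hom_of_kernelι_eq_zero {X Y : EquivariantObject ρ} (f : X ⟶ Y)
    (h : kernelι f = 0) : Mono f.hom :=
  Preadditive.mono_of_kernel_zero (congrArg Hom.hom h)

/-- The kernel taken in C carries an equivariant structure, so a monomorphism of C^G already sees
that it vanishes. -/
theorem mono_hom_of_mono {X Y : EquivariantObject ρ} (f : X ⟶ Y) [Mono f] : Mono f.hom := by
  apply mono_hom_of_kernelι_eq_zero
  rw [← cancel_mono f, kernelι_comp, zero_comp]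

/-- A nonzero morphism out of a simple equivariant object is a monomorphism. -/
theorem mono_of_ne_zero {S X : EquivariantObject ρ} [Simple S] (f : S ⟶ X) (hf : f ≠ 0) :
    Mono f := by
  have h0 : kernelι f = 0 := by
    -- By simplicity a nonzero kernel inclusion is an isomorphism, which forces `f = 0`.
    by_contra h
    have := isIso_of_mono_of_nonzero h
    exact hf ((cancel_epi (kernelι f)).1 ((kernelι_comp f).trans comp_zero.symm))
  have := mono_hom_of_kernelι_eq_zero f h0
  exact mono_of_mono_hom f

/-- Half of Schur's lemma: it reduces the search for a subobject to the search for a nonzero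
morphism. -/
theorem isConstituent_iff {S X : EquivariantObject ρ} (hS : Simple S) :
    IsConstituent S X ↔ ∃ f : S ⟶ X, f ≠ 0 := by
  constructor
  · rintro ⟨-, i, hi⟩
    refine ⟨i, fun h => id_nonzero S ?_⟩
    rw [← cancel_mono i, h, comp_zero, comp_zero]
  · rintro ⟨f, hf⟩
    exact ⟨hS, f, mono_of_ne_zero f hf⟩

end EquivariantObject

/-! ### Frobenius reciprocity for the induced object. -/

namespace LinearAction

variable {k : Type*} [Field k] {G : Type*} [Group G] {C : Type u} [Category.{v} C]
  [Abelian C] [Linear k C] (ρ : LinearAction k G C) {H : Subgroup G} (R : G ⧸ H → G)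
  (hR : ∀ q, (R q : G ⧸ H) = q) (N : EquivariantObject (ρ.restrict H))

/-- The action of `h ∈ H` on an `H`-equivariant object. -/
def restrictAct (h : H) : (ρ.F h).obj N.obj ⟶ N.obj := N.act h

theorem restrictAct_mul (a b : H) :
    (ρ.F a).map (ρ.restrictAct N b) ≫ ρ.restrictAct N a =
      (ρ.mulApp (rfl : (a * b : G) = (a * b : H)) N.obj).hom ≫ ρ.restrictAct N (a * b) :=
  N.act_mulApp rfl

theorem oneApp_restrictAct : (ρ.oneApp N.obj).hom ≫ ρ.restrictAct N 1 = 𝟙 _ := N.act_one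

instance (h : H) : IsIso (ρ.restrictAct N h) := N.isIso_act h

/-- The element `h ∈ H` with `1 = R(H) h`. -/
def unitElement : H := ⟨(R (1 : G))⁻¹, H.inv_mem (by
  have := QuotientGroup.eq.1 (hR (1 : G)).symm
  simpa using this)⟩

/-- The representative of the trivial coset need not be `1`; this factor corrects for it in the
unit. -/
theorem unitElement_spec : R ((1 : G) : G ⧸ H) * (unitElement R hR : G) = 1 := by
  simp [unitElement]

variable [Finite G]

/-- The inclusion of the summand `ρ^{R(q)}(N)` into the induced object. -/
def inductionι (q : G ⧸ H) : (ρ.F (R q)).obj N.obj ⟶ (ρ.induction R hR N).obj :=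
  biproduct.ι (fun q => (ρ.F (R q)).obj N.obj) q

/-- The projection of the induced object to the summand `ρ^{R(q)}(N)`. -/
def inductionπ (q : G ⧸ H) : (ρ.induction R hR N).obj ⟶ (ρ.F (R q)).obj N.obj :=
  biproduct.π (fun q => (ρ.F (R q)).obj N.obj) q

theorem inductionι_π_self (q : G ⧸ H) :
    ρ.inductionι R hR N q ≫ ρ.inductionπ R hR N q = 𝟙 _ :=
  biproduct.ι_π_self _ _

theorem inductionι_π_ne {q q' : G ⧸ H} (h : q ≠ q') :
    ρ.inductionι R hR N q ≫ ρ.inductionπ R hR N q' = 0 :=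
  biproduct.ι_π_ne _ h

theorem induction_hom_ext {X : C} {f f' : (ρ.induction R hR N).obj ⟶ X}
    (h : ∀ q, ρ.inductionι R hR N q ≫ f = ρ.inductionι R hR N q ≫ f') : f = f' :=
  biproduct.hom_ext' _ _ h

theorem map_induction_hom_ext (F : C ⥤ C) [F.Additive] {X : C}
    {f f' : F.obj (ρ.induction R hR N).obj ⟶ X}
    (h : ∀ q, F.map (ρ.inductionι R hR N q) ≫ f = F.map (ρ.inductionι R hR N q) ≫ f') : f = f' :=
  map_biproduct_hom_ext F _ h

theorem sum_inductionπ_ι [Fintype (G ⧸ H)] :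
    ∑ q, ρ.inductionπ R hR N q ≫ ρ.inductionι R hR N q = 𝟙 _ := by
  refine ρ.induction_hom_ext R hR N fun q => ?_
  rw [Preadditive.comp_sum, Finset.sum_eq_single q]
  · rw [reassoc_of% ρ.inductionι_π_self R hR N q, Category.comp_id]
  · intro q' _ h
    rw [reassoc_of% ρ.inductionι_π_ne R hR N h.symm, zero_comp]
  · exact fun h => absurd (Finset.mem_univ q) h

/-- For `g = R(q)h`, the morphism `ρ^g(N) ≅ ρ^{R(q)} ρ^h(N) → ρ^{R(q)}(N)` into the induced
object. -/
def leg {q : G ⧸ H} {h : H} {g : G} (e : R q * h = g) :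
    (ρ.F g).obj N.obj ⟶ (ρ.induction R hR N).obj :=
  (ρ.mulApp e N.obj).inv ≫ (ρ.F (R q)).map (ρ.restrictAct N h) ≫ ρ.inductionι R hR N q

/-- The factorisation of `g` into a representative and an element of `H` is unique, so a leg depends
on `g` alone and any convenient factorisation may be used. -/
theorem leg_congr {q q' : G ⧸ H} {h h' : H} {g : G} (e : R q * h = g) (e' : R q' * h' = g) :
    ρ.leg R hR N e = ρ.leg R hR N e' := by
  have hq : q = q' := by
    rw [← hR q, ← hR q']
    apply QuotientGroup.eq.2
    have : (R q)⁻¹ * R q' = h * (h'⁻¹ : H) := by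
      rw [← mul_left_cancel_iff (a := R q), mul_inv_cancel_left, ← mul_assoc, e, ← e']
      simp
    rw [this]
    exact (h * h'⁻¹).2
  subst hq
  obtain rfl : h = h' := Subtype.ext (mul_left_cancel (e.trans e'.symm))
  rfl

theorem map_inductionι_act (g : G) (q : G ⧸ H) :
    (ρ.F g).map (ρ.inductionι R hR N q) ≫ (ρ.induction R hR N).act g =
      (ρ.mulApp (rfl : g * R q = g * R q) N.obj).hom ≫
        ρ.leg R hR N (cosetElement_spec R hR g q) := by
  refine (map_ι_mapDesc (ρ.F g) (fun q => (ρ.F (R q)).obj N.obj) _ q).trans ?_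
  simp only [LinearAction.component, mul_hom_app, leg, mulIso_inv_app, Category.assoc]
  rfl

/-- The analogue of the relation gh ⊗ n = g ⊗ hn in an induced module. It comes from
multiplicativity of the `H`-action on `N` and the associativity of the structure isomorphisms. -/
theorem map_act_leg {q q' : G ⧸ H} {h x x' : H} {g b : G} (e : R q * x = g) (eb : g * h = b)
    (e' : R q' * x' = b) :
    (ρ.F g).map (ρ.restrictAct N h) ≫ ρ.leg R hR N e = (ρ.mulApp eb N.obj).hom ≫ ρ.leg R hR N e' := by
  have e'' : R q * ((x * h : H) : G) = b := by rw [Subgroup.coe_mul, ← mul_assoc, e, eb]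
  rw [ρ.leg_congr R hR N e' e'', leg, leg, reassoc_of% ρ.mulApp_inv_naturality e (ρ.restrictAct N h),
    ← Functor.map_comp_assoc, restrictAct_mul, Functor.map_comp, Category.assoc,
    Iso.inv_comp_eq, reassoc_of% ρ.mulApp_assoc e (rfl : (x * h : G) = (x * h : H)) eb e'',
    Iso.hom_inv_id_assoc]

/-- The action on the induced object permutes the `leg`s. -/
theorem map_leg_act {q q' : G ⧸ H} {h h' : H} {g a b : G} (e : R q * h = g) (eb : a * g = b)
    (e' : R q' * h' = b) :
    (ρ.F a).map (ρ.leg R hR N e) ≫ (ρ.induction R hR N).act a =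
      (ρ.mulApp eb N.obj).hom ≫ ρ.leg R hR N e' := by
  have e3 : a * R q * h = b := by rw [mul_assoc, e, eb]
  rw [leg]
  simp only [Functor.map_comp, Category.assoc]
  rw [map_inductionι_act, reassoc_of% ρ.mulApp_naturality,
    ρ.map_act_leg R hR N (cosetElement_spec R hR a q) e3 e',
    reassoc_of% ρ.map_mulApp_inv_comp rfl e e3 eb, Iso.inv_hom_id_assoc]

theorem leg_self (q : G ⧸ H) (e : R q * (1 : H) = R q) :
    ρ.leg R hR N e = ρ.inductionι R hR N q := by
  have h2 : (ρ.mulApp e N.obj).inv = (ρ.F (R q)).map (ρ.oneApp N.obj).hom := by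
    rw [← cancel_mono (ρ.mulApp e N.obj).hom, Iso.inv_hom_id]
    exact (ρ.map_oneApp_mulApp e N.obj).symm
  rw [leg, h2, ← Functor.map_comp_assoc, oneApp_restrictAct, CategoryTheory.Functor.map_id, Category.id_comp]

/-- The unit `N → L(N)` of Frobenius reciprocity. -/
def inductionUnit : N.obj ⟶ (ρ.induction R hR N).obj :=
  (ρ.oneApp N.obj).hom ≫ ρ.leg R hR N (unitElement_spec R hR)

/-- The unit is `H`-equivariant. -/
theorem act_inductionUnit (h : H) :
    ρ.restrictAct N h ≫ ρ.inductionUnit R hR N =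
      (ρ.F h).map (ρ.inductionUnit R hR N) ≫ (ρ.induction R hR N).act h := by
  have e : R ((1 : G) : G ⧸ H) * ((unitElement R hR * h : H) : G) = h := by
    rw [Subgroup.coe_mul, ← mul_assoc, unitElement_spec, one_mul]
  rw [inductionUnit, reassoc_of% ρ.oneApp_naturality (ρ.restrictAct N h),
    ρ.map_act_leg R hR N (unitElement_spec R hR) (one_mul (h : G)) e,
    reassoc_of% ρ.oneApp_mulApp (one_mul (h : G)), Functor.map_comp, Category.assoc,
    ρ.map_leg_act R hR N (unitElement_spec R hR) (mul_one (h : G)) e,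
    reassoc_of% ρ.map_oneApp_mulApp (mul_one (h : G))]

/-- The unit generates the induced object. -/
theorem map_inductionUnit_act (q : G ⧸ H) :
    (ρ.F (R q)).map (ρ.inductionUnit R hR N) ≫ (ρ.induction R hR N).act (R q) =
      ρ.inductionι R hR N q := by
  have e : R q * ((1 : H) : G) = R q := by simp
  rw [inductionUnit, Functor.map_comp, Category.assoc,
    ρ.map_leg_act R hR N (unitElement_spec R hR) (mul_one (R q)) e,
    reassoc_of% ρ.map_oneApp_mulApp (mul_one (R q)), leg_self]

/-- The isomorphism of `N` with the summand of the trivial coset in `L(N)`. -/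
theorem inductionUnit_eq :
    ∃ θ : N.obj ≅ (ρ.F (R (1 : G))).obj N.obj,
      ρ.inductionUnit R hR N = θ.hom ≫ ρ.inductionι R hR N (1 : G) := by
  refine ⟨ρ.oneApp N.obj ≪≫ (ρ.mulApp (unitElement_spec R hR) N.obj).symm ≪≫
    (ρ.F (R (1 : G))).mapIso (asIso (ρ.restrictAct N (unitElement R hR))), ?_⟩
  simp only [inductionUnit, leg, Iso.trans_hom, Iso.symm_hom, Functor.mapIso_hom, asIso_hom,
    Category.assoc]

variable {X : EquivariantObject ρ}

/-- Uniqueness half of Frobenius reciprocity: the unit generates the induced object, so its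
composite with `f` determines `f`. -/
theorem inductionι_comp_hom (f : ρ.induction R hR N ⟶ X) (q : G ⧸ H) :
    ρ.inductionι R hR N q ≫ f.hom =
      (ρ.F (R q)).map (ρ.inductionUnit R hR N ≫ f.hom) ≫ X.act (R q) := by
  rw [← map_inductionUnit_act, Category.assoc, EquivariantObject.hom_comm, Functor.map_comp,
    Category.assoc]

/-- The underlying morphism of `inductionDesc`. -/
def inductionDescHom (u : N.obj ⟶ X.obj) : (ρ.induction R hR N).obj ⟶ X.obj :=
  biproduct.desc fun q => (ρ.F (R q)).map u ≫ X.act (R q)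

theorem inductionι_descHom (u : N.obj ⟶ X.obj) (q : G ⧸ H) :
    ρ.inductionι R hR N q ≫ ρ.inductionDescHom R hR N u =
      (ρ.F (R q)).map u ≫ X.act (R q) :=
  biproduct.ι_desc _ q

/-- `H`-equivariance of `u` absorbs the factor `h`, so the value on a leg mentions only `g`. This
makes the extension of `u` commute with all of `G`. -/
theorem leg_descHom (u : N.obj ⟶ X.obj)
    (hu : ∀ h : H, ρ.restrictAct N h ≫ u = (ρ.F h).map u ≫ X.act h)
    {q : G ⧸ H} {h : H} {g : G} (e : R q * h = g) :
    ρ.leg R hR N e ≫ ρ.inductionDescHom R hR N u = (ρ.F g).map u ≫ X.act g := by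
  rw [leg, Category.assoc, Category.assoc, inductionι_descHom, ← Functor.map_comp_assoc, hu,
    Functor.map_comp, Category.assoc, X.act_mulApp e, reassoc_of% ρ.mulApp_naturality e,
    Iso.inv_hom_id_assoc]

/-- The morphism `L(N) → X` attached to an `H`-equivariant morphism `N → X`. -/
def inductionDesc (u : N.obj ⟶ X.obj)
    (hu : ∀ h : H, ρ.restrictAct N h ≫ u = (ρ.F h).map u ≫ X.act h) : ρ.induction R hR N ⟶ X where
  hom := ρ.inductionDescHom R hR N u
  comm a := by
    apply ρ.map_induction_hom_ext R hR N (ρ.F a)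
    intro q
    rw [← Category.assoc, map_inductionι_act, Category.assoc, leg_descHom _ _ _ _ _ hu,
      ← Functor.map_comp_assoc, inductionι_descHom, Functor.map_comp, Category.assoc,
      X.act_mulApp rfl, reassoc_of% ρ.mulApp_naturality]

theorem inductionUnit_desc (u : N.obj ⟶ X.obj)
    (hu : ∀ h : H, ρ.restrictAct N h ≫ u = (ρ.F h).map u ≫ X.act h) :
    ρ.inductionUnit R hR N ≫ (ρ.inductionDesc R hR N u hu).hom = u := by
  change _ ≫ ρ.inductionDescHom R hR N u = u
  rw [inductionUnit, Category.assoc, leg_descHom _ _ _ _ _ hu,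
    ← reassoc_of% ρ.oneApp_naturality u, X.oneApp_act, Category.comp_id]

end LinearAction

/-! ### The object V ⊗ Y described through vectors instead of a basis. -/

section Copower

variable {k : Type*} [Field k] {C : Type u} [Category.{v} C] [Abelian C] [Linear k C]
  {V : Type*} [AddCommGroup V] [Module k V] [FiniteDimensional k V]

/-- The morphism `v ⊗ id : Y → V ⊗ Y` for `v ∈ V`. -/
def copowerElem (k : Type*) [Field k] [Linear k C] {V : Type*} [AddCommGroup V] [Module k V]
    [FiniteDimensional k V] (Y : C) : V →ₗ[k] (Y ⟶ copower k V Y) :=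
  (Module.finBasis k V).constr k fun i => biproduct.ι (fun _ : Fin (Module.finrank k V) => Y) i

/-- The coordinate `V ⊗ Y → Y` with respect to the chosen basis of `V`. -/
def copowerπ (k : Type*) [Field k] (V : Type*) [AddCommGroup V] [Module k V] (Y : C)
    (i : Fin (Module.finrank k V)) : copower k V Y ⟶ Y :=
  biproduct.π (fun _ : Fin (Module.finrank k V) => Y) i

theorem copowerElem_apply (Y : C) (v : V) :
    copowerElem k Y v = ∑ i, (Module.finBasis k V).repr v i •
      biproduct.ι (fun _ : Fin (Module.finrank k V) => Y) i :=
  Module.Basis.constr_apply_fintype ..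

theorem copowerElem_basis (Y : C) (i : Fin (Module.finrank k V)) :
    copowerElem k Y (Module.finBasis k V i) =
      biproduct.ι (fun _ : Fin (Module.finrank k V) => Y) i :=
  Module.Basis.constr_basis ..

theorem map_copower_hom_ext (F : C ⥤ C) [F.Additive] {Y Z : C} {f f' : F.obj (copower k V Y) ⟶ Z}
    (h : ∀ v : V, F.map (copowerElem k Y v) ≫ f = F.map (copowerElem k Y v) ≫ f') : f = f' :=
  map_biproduct_hom_ext F _ fun i => by rw [← copowerElem_basis, h]

theorem copower_hom_ext {Y Z : C} {f f' : copower k V Y ⟶ Z}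
    (h : ∀ v : V, copowerElem k Y v ≫ f = copowerElem k Y v ≫ f') : f = f' :=
  map_copower_hom_ext (𝟭 C) h

/-- Replaces the matrix in `copowerMap` by the action of `a` on vectors; linearity of `F` lets the
coordinates of `v` pass through it. -/
theorem map_copowerElem_comp_copowerMap (F : C ⥤ C) [F.Additive] [F.Linear k] (a : V →ₗ[k] V)
    {Y Z : C} (f : F.obj Y ⟶ Z) (v : V) :
    F.map (copowerElem k Y v) ≫ copowerMap F a f = f ≫ copowerElem k Z (a v) := by
  rw [copowerElem_apply, copowerElem_apply, F.map_sum, Preadditive.sum_comp]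
  simp only [F.map_smul, Linear.smul_comp, map_ι_copowerMap, Preadditive.comp_sum,
    Linear.comp_smul, Finset.smul_sum, smul_smul]
  rw [Finset.sum_comm]
  refine Finset.sum_congr rfl fun j _ => ?_
  rw [← Finset.sum_smul, ← LinearMap.toMatrix_mulVec_repr (Module.finBasis k V)]
  congr 1
  exact Finset.sum_congr rfl fun _ _ => mul_comm _ _

/-- The morphism `V ⊗ Y → X` attached to a linear map `V → Hom(Y, X)`. -/
def copowerDesc {Y X : C} (φ : V →ₗ[k] (Y ⟶ X)) : copower k V Y ⟶ X :=
  biproduct.desc fun i => φ (Module.finBasis k V i)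

theorem copowerElem_desc {Y X : C} (φ : V →ₗ[k] (Y ⟶ X)) (v : V) :
    copowerElem k Y v ≫ copowerDesc φ = φ v := by
  rw [copowerElem_apply, Preadditive.sum_comp]
  conv_rhs => rw [← (Module.finBasis k V).sum_repr v, map_sum]
  refine Finset.sum_congr rfl fun i _ => ?_
  rw [Linear.smul_comp, copowerDesc, biproduct.ι_desc, map_smul]

theorem copowerElem_π (Y : C) (v : V) (i : Fin (Module.finrank k V)) :
    copowerElem k Y v ≫ copowerπ k V Y i = (Module.finBasis k V).repr v i • 𝟙 Y := by
  rw [copowerElem_apply, Preadditive.sum_comp, Finset.sum_eq_single i]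
  · rw [Linear.smul_comp, copowerπ, biproduct.ι_π_self]
  · intro j _ hj
    rw [Linear.smul_comp, copowerπ, biproduct.ι_π_ne _ hj, smul_zero]
  · exact fun h => absurd (Finset.mem_univ i) h

theorem sum_copowerπ_elem (Y : C) :
    ∑ i, copowerπ k V Y i ≫ copowerElem k Y (Module.finBasis k V i) = 𝟙 (copower k V Y) := by
  refine copower_hom_ext fun v => ?_
  rw [Preadditive.comp_sum, Category.comp_id]
  conv_rhs => rw [← (Module.finBasis k V).sum_repr v, map_sum]
  refine Finset.sum_congr rfl fun i _ => ?_
  rw [← Category.assoc, copowerElem_π, Linear.smul_comp, Category.id_comp, map_smul]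

end Copower

/-- In a fusion category a nonzero morphism onto a simple object splits. -/
theorem exists_section_of_ne_zero (k : Type*) [Field k] {C : Type u} [Category.{v} C] [Abelian C]
    [Linear k C] [MonoidalCategory C] [MonoidalPreadditive C] [MonoidalLinear k C]
    [RigidCategory C] [IsFusionCategory k C] {X T : C} [Simple T] (f : X ⟶ T) (hf : f ≠ 0) :
    ∃ s : T ⟶ X, s ≫ f = 𝟙 T := by
  obtain ⟨n, S, hS, ⟨e⟩⟩ := IsFusionCategory.semisimple k X
  by_cases h : ∀ i, biproduct.ι S i ≫ e.inv ≫ f = 0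
  · refine absurd ?_ hf
    rw [← cancel_epi e.inv, comp_zero]
    exact biproduct.hom_ext' _ _ fun i => by rw [h, comp_zero]
  -- Some simple summand of `X` maps to `T` by a nonzero morphism, hence isomorphically; its inverse
  -- followed by the inclusion is a section.
  · push Not at h
    obtain ⟨i, hi⟩ := h
    have := hS i
    have := isIso_of_hom_simple hi
    refine ⟨inv (biproduct.ι S i ≫ e.inv ≫ f) ≫ biproduct.ι S i ≫ e.inv, ?_⟩
    rw [Category.assoc, Category.assoc, IsIso.inv_hom_id]

/-! ### Morphisms out of S_{U,π}, and its simplicity. -/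

namespace LinearAction

variable {k : Type*} [Field k] {G : Type*} [Group G] {C : Type u} [Category.{v} C]
  [Abelian C] [Linear k C] (ρ : LinearAction k G C) {U : C} (c : ρ.InertiaIsos U)

instance simple_F_obj (g : G) [Simple U] : Simple ((ρ.F g).obj U) :=
  simple_obj (ρ.F g) U

/-- The operator of `g ∈ G_U` on `Hom_C(U, X)` for an equivariant object `X`. -/
def homAct (X : EquivariantObject ρ) (g : ρ.inertia U) : (U ⟶ X.obj) →ₗ[k] (U ⟶ X.obj) :=
  Linear.leftComp k _ (c g).inv ∘ₗ Linear.rightComp k _ (X.act g) ∘ₗ (ρ.F g).mapLinearMap k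

theorem homAct_apply (X : EquivariantObject ρ) (g : ρ.inertia U) (f : U ⟶ X.obj) :
    ρ.homAct c X g f = (c g).inv ≫ (ρ.F g).map f ≫ X.act g := rfl

theorem homAct_comp_hom {X X' : EquivariantObject ρ} (i : X ⟶ X') (g : ρ.inertia U)
    (f : U ⟶ X.obj) : ρ.homAct c X' g (f ≫ i.hom) = ρ.homAct c X g f ≫ i.hom := by
  simp only [homAct_apply, Functor.map_comp, Category.assoc, EquivariantObject.hom_comm]

variable [IsAlgClosed k] [Simple U] [FiniteDimensional k (U ⟶ U)]

/-- The structure maps of `X` are strictly multiplicative, so the whole scalar comes from the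
inverses of the `c g`. Hence Hom_C(U, X) has the factor set of the representations that define
S_{U,π}. -/
theorem homAct_comp (X : EquivariantObject ρ) (g h : ρ.inertia U) :
    ρ.homAct c X g ∘ₗ ρ.homAct c X h = ρ.factorSet c g h • ρ.homAct c X (g * h) := by
  ext f
  have h1 := ρ.inertiaIso_inv_comp c g h
  rw [mul_hom_app] at h1
  simp only [LinearMap.comp_apply, LinearMap.smul_apply, homAct_apply, Functor.map_comp,
    Category.assoc]
  rw [X.act_mulApp rfl, reassoc_of% ρ.mulApp_naturality, reassoc_of% h1, Linear.smul_comp]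
  rfl

variable {V : Type*} [AddCommGroup V] [Module k V] [FiniteDimensional k V]
  (π : ProjRep (ρ.factorSet c) V)

/-- The morphism `v ⊗ id : U → V ⊗ U` into the equivariant object `V ⊗ U`. -/
def repElem : V →ₗ[k] (U ⟶ (ρ.projRepTensor c π).obj) := copowerElem k U

/-- The coordinates `V ⊗ U → U`. -/
def repCoord (i : Fin (Module.finrank k V)) : (ρ.projRepTensor c π).obj ⟶ U := copowerπ k V U i

/-- The morphism `V ⊗ U → X` attached to a linear map `V → Hom(U, X)`. -/
def repDesc {X : C} (φ : V →ₗ[k] (U ⟶ X)) : (ρ.projRepTensor c π).obj ⟶ X := copowerDesc φ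

theorem repElem_desc {X : C} (φ : V →ₗ[k] (U ⟶ X)) (v : V) :
    ρ.repElem c π v ≫ ρ.repDesc c π φ = φ v := copowerElem_desc φ v

theorem repElem_coord (v : V) (i : Fin (Module.finrank k V)) :
    ρ.repElem c π v ≫ ρ.repCoord c π i = (Module.finBasis k V).repr v i • 𝟙 U :=
  copowerElem_π U v i

theorem sum_repCoord_elem :
    ∑ i, ρ.repCoord c π i ≫ ρ.repElem c π (Module.finBasis k V i) = 𝟙 _ :=
  sum_copowerπ_elem U

theorem map_rep_hom_ext (F : C ⥤ C) [F.Additive] {Z : C}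
    {f f' : F.obj (ρ.projRepTensor c π).obj ⟶ Z}
    (h : ∀ v : V, F.map (ρ.repElem c π v) ≫ f = F.map (ρ.repElem c π v) ≫ f') : f = f' :=
  map_copower_hom_ext (k := k) (V := V) F h

theorem rep_hom_ext {Z : C} {f f' : (ρ.projRepTensor c π).obj ⟶ Z}
    (h : ∀ v : V, ρ.repElem c π v ≫ f = ρ.repElem c π v ≫ f') : f = f' :=
  copower_hom_ext (k := k) (V := V) h

theorem map_repElem_comp_restrictAct (g : ρ.inertia U) (v : V) :
    (ρ.F g).map (ρ.repElem c π v) ≫ ρ.restrictAct (ρ.projRepTensor c π) g =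
      (c g).hom ≫ ρ.repElem c π (π.toFun g v) :=
  map_copowerElem_comp_copowerMap (ρ.F g) _ _ _

variable [Finite G] (R : G ⧸ ρ.inertia U → G) (hR : ∀ q, (R q : G ⧸ ρ.inertia U) = q)

/-- The morphism `ρ^{R(q)}(v ⊗ id) : ρ^{R(q)}(U) → S_{U,π}` for `v ∈ V`. -/
def simpleι (q : G ⧸ ρ.inertia U) : V →ₗ[k] ((ρ.F (R q)).obj U ⟶ (ρ.simpleObject c R hR π).obj) :=
  Linear.rightComp k _ (ρ.inductionι R hR (ρ.projRepTensor c π) q) ∘ₗ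
    (ρ.F (R q)).mapLinearMap k ∘ₗ ρ.repElem c π

/-- The coordinates `S_{U,π} → ρ^{R(q)}(U)`. -/
def simpleπ (q : G ⧸ ρ.inertia U) (i : Fin (Module.finrank k V)) :
    (ρ.simpleObject c R hR π).obj ⟶ (ρ.F (R q)).obj U :=
  ρ.inductionπ R hR (ρ.projRepTensor c π) q ≫ (ρ.F (R q)).map (ρ.repCoord c π i)

theorem simpleι_π_self (q : G ⧸ ρ.inertia U) (v : V) (i : Fin (Module.finrank k V)) :
    ρ.simpleι c π R hR q v ≫ ρ.simpleπ c π R hR q i = (Module.finBasis k V).repr v i • 𝟙 _ := by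
  change ((ρ.F (R q)).map (ρ.repElem c π v) ≫ ρ.inductionι R hR (ρ.projRepTensor c π) q) ≫
    ρ.inductionπ R hR (ρ.projRepTensor c π) q ≫ (ρ.F (R q)).map (ρ.repCoord c π i) = _
  rw [Category.assoc, reassoc_of% ρ.inductionι_π_self R hR, ← Functor.map_comp, repElem_coord,
    Functor.map_smul, CategoryTheory.Functor.map_id]

theorem simpleι_π_ne {q q' : G ⧸ ρ.inertia U} (h : q ≠ q') (v : V)
    (i : Fin (Module.finrank k V)) :
    ρ.simpleι c π R hR q v ≫ ρ.simpleπ c π R hR q' i = 0 := by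
  change ((ρ.F (R q)).map (ρ.repElem c π v) ≫ ρ.inductionι R hR (ρ.projRepTensor c π) q) ≫
    ρ.inductionπ R hR (ρ.projRepTensor c π) q' ≫ (ρ.F (R q')).map (ρ.repCoord c π i) = _
  rw [Category.assoc, reassoc_of% ρ.inductionι_π_ne R hR _ h, zero_comp, comp_zero]

theorem sum_simpleπ_ι [Fintype (G ⧸ ρ.inertia U)] :
    ∑ q, ∑ i, ρ.simpleπ c π R hR q i ≫ ρ.simpleι c π R hR q (Module.finBasis k V i) = 𝟙 _ := by
  refine Eq.trans (Finset.sum_congr rfl fun q _ => ?_)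
    (ρ.sum_inductionπ_ι R hR (ρ.projRepTensor c π))
  change ∑ i, (ρ.inductionπ R hR (ρ.projRepTensor c π) q ≫ (ρ.F (R q)).map (ρ.repCoord c π i)) ≫
    (ρ.F (R q)).map (ρ.repElem c π (Module.finBasis k V i)) ≫
      ρ.inductionι R hR (ρ.projRepTensor c π) q = _
  simp only [Category.assoc]
  rw [← Preadditive.comp_sum]
  congr 1
  simp only [← Functor.map_comp_assoc]
  rw [← Preadditive.sum_comp, ← Functor.map_sum, sum_repCoord_elem, CategoryTheory.Functor.map_id,
    Category.id_comp]

/-- The inclusion `v ↦ (U → V ⊗ U → S_{U,π})` of `V` into `Hom_C(U, S_{U,π})`. -/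
def simpleUnit : V →ₗ[k] (U ⟶ (ρ.simpleObject c R hR π).obj) :=
  Linear.rightComp k _ (ρ.inductionUnit R hR (ρ.projRepTensor c π)) ∘ₗ ρ.repElem c π

theorem simpleUnit_apply (v : V) : ρ.simpleUnit c π R hR v =
    ρ.repElem c π v ≫ ρ.inductionUnit R hR (ρ.projRepTensor c π) := rfl

/-- The unit is equivariant under G_U and `c g` cancels its inverse, leaving only the operator of
`π`. -/
theorem homAct_simpleUnit (g : ρ.inertia U) (v : V) :
    ρ.homAct c _ g (ρ.simpleUnit c π R hR v) = ρ.simpleUnit c π R hR (π.toFun g v) := by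
  change (c g).inv ≫ (ρ.F g).map (ρ.repElem c π v ≫
    ρ.inductionUnit R hR (ρ.projRepTensor c π)) ≫
      (ρ.induction R hR (ρ.projRepTensor c π)).act g =
    ρ.repElem c π (π.toFun g v) ≫ ρ.inductionUnit R hR (ρ.projRepTensor c π)
  rw [Functor.map_comp, Category.assoc, ← act_inductionUnit,
    reassoc_of% ρ.map_repElem_comp_restrictAct c π g v, Iso.inv_hom_id_assoc]

/-- A morphism out of `S_{U,π}` is determined by its restriction to `V ⊗ U`. -/
theorem simpleObject_hom_ext {X : EquivariantObject ρ} {f f' : ρ.simpleObject c R hR π ⟶ X}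
    (h : ∀ v, ρ.simpleUnit c π R hR v ≫ f.hom = ρ.simpleUnit c π R hR v ≫ f'.hom) : f = f' := by
  change ρ.induction R hR (ρ.projRepTensor c π) ⟶ X at f f'
  have h1 : ρ.inductionUnit R hR (ρ.projRepTensor c π) ≫ f.hom =
      ρ.inductionUnit R hR (ρ.projRepTensor c π) ≫ f'.hom :=
    ρ.rep_hom_ext c π fun v =>
      (Category.assoc _ _ _).symm.trans ((h v).trans (Category.assoc _ _ _))
  refine EquivariantObject.hom_ext (ρ.induction_hom_ext R hR _ fun q => ?_)
  rw [inductionι_comp_hom, inductionι_comp_hom, h1]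

/-- Every intertwiner `V → Hom_C(U, X)` comes from a morphism `S_{U,π} → X`. -/
theorem exists_simpleObject_hom {X : EquivariantObject ρ} (φ : V →ₗ[k] (U ⟶ X.obj))
    (hφ : ∀ g v, ρ.homAct c X g (φ v) = φ (π.toFun g v)) :
    ∃ f : ρ.simpleObject c R hR π ⟶ X, ∀ v, ρ.simpleUnit c π R hR v ≫ f.hom = φ v := by
  have hu : ∀ h : ρ.inertia U, ρ.restrictAct (ρ.projRepTensor c π) h ≫ ρ.repDesc c π φ =
      (ρ.F h).map (ρ.repDesc c π φ) ≫ X.act h := by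
    intro h
    -- Tested on vectors, equivariance of the induced map V ⊗ U → X is exactly the intertwining
    -- property of `φ`.
    refine ρ.map_rep_hom_ext c π (ρ.F h) fun v => ?_
    rw [reassoc_of% ρ.map_repElem_comp_restrictAct c π h v, repElem_desc, ← hφ,
      homAct_apply, Iso.hom_inv_id_assoc, ← Functor.map_comp_assoc, repElem_desc]
  refine ⟨ρ.inductionDesc R hR (ρ.projRepTensor c π) (ρ.repDesc c π φ) hu, fun v => ?_⟩
  have h1 := ρ.inductionUnit_desc R hR (ρ.projRepTensor c π) (ρ.repDesc c π φ) hu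
  have h2 := ρ.repElem_desc c π φ v
  rw [← h1, ← Category.assoc] at h2
  exact h2

/-- Frobenius reciprocity combined with the universal property of V ⊗ U; it moves the question from
C^G to linear algebra over G_U. -/
theorem exists_simpleObject_hom_ne_zero_iff (X : EquivariantObject ρ) :
    (∃ f : ρ.simpleObject c R hR π ⟶ X, f ≠ 0) ↔
      ∃ φ : V →ₗ[k] (U ⟶ X.obj), φ ≠ 0 ∧ ∀ g v, ρ.homAct c X g (φ v) = φ (π.toFun g v) := by
  constructor
  · rintro ⟨f, hf⟩
    refine ⟨Linear.rightComp k _ f.hom ∘ₗ ρ.simpleUnit c π R hR, fun h => hf ?_, fun g v => ?_⟩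
    · refine ρ.simpleObject_hom_ext c π R hR fun v => ?_
      rw [EquivariantObject.zero_hom, comp_zero]
      exact LinearMap.congr_fun h v
    · exact (ρ.homAct_comp_hom c f g _).trans
        (congrArg (· ≫ f.hom) (ρ.homAct_simpleUnit c π R hR g v))
  · rintro ⟨φ, h0, hφ⟩
    obtain ⟨f, hf⟩ := ρ.exists_simpleObject_hom c π R hR φ hφ
    refine ⟨f, ?_⟩
    rintro rfl
    refine h0 (LinearMap.ext fun v => ?_)
    rw [← hf, EquivariantObject.zero_hom, comp_zero, LinearMap.zero_apply]

/-- A morphism to `S_{U,π}` vanishes if its coordinates do. -/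
theorem eq_zero_of_comp_simpleπ {X : C} (f : X ⟶ (ρ.simpleObject c R hR π).obj)
    (h : ∀ q i, f ≫ ρ.simpleπ c π R hR q i = 0) : f = 0 := by
  have := Fintype.ofFinite (G ⧸ ρ.inertia U)
  rw [← Category.comp_id f, ← sum_simpleπ_ι, Preadditive.comp_sum]
  refine Finset.sum_eq_zero fun q _ => ?_
  rw [Preadditive.comp_sum]
  refine Finset.sum_eq_zero fun i _ => ?_
  rw [← Category.assoc, h, zero_comp]

/-- `Hom_C(U, S_{U,π})` is exhausted by `V`. -/
theorem simpleUnit_surjective : Function.Surjective (ρ.simpleUnit c π R hR) := by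
  intro f
  obtain ⟨θ, hθ⟩ := ρ.inductionUnit_eq R hR (ρ.projRepTensor c π)
  change U ⟶ (ρ.induction R hR (ρ.projRepTensor c π)).obj at f
  have hθ' : ρ.inductionUnit R hR (ρ.projRepTensor c π) ≫
      ρ.inductionπ R hR (ρ.projRepTensor c π) (1 : G) ≫ θ.inv = 𝟙 _ := by
    rw [hθ, Category.assoc, reassoc_of% ρ.inductionι_π_self R hR, Iso.hom_inv_id]
  set f' : U ⟶ (ρ.projRepTensor c π).obj :=
    f ≫ ρ.inductionπ R hR (ρ.projRepTensor c π) (1 : G) ≫ θ.inv with hf'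
  -- Each coordinate of `f'` is an endomorphism of the simple object `U`, thus a scalar by Schur;
  -- these scalars are the coordinates of the preimage.
  refine ⟨∑ i, schurScalar k (f' ≫ ρ.repCoord c π i) • Module.finBasis k V i, ?_⟩
  have h3 : ρ.repElem c π (∑ i, schurScalar k (f' ≫ ρ.repCoord c π i) • Module.finBasis k V i) =
      f' := by
    conv_rhs => rw [← Category.comp_id f', ← sum_repCoord_elem, Preadditive.comp_sum]
    rw [map_sum]
    refine Finset.sum_congr rfl fun i _ => ?_
    rw [map_smul, ← Category.assoc]
    conv_rhs => rw [← schurScalar_spec k (f' ≫ ρ.repCoord c π i)]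
    rw [Linear.smul_comp, Category.id_comp]
  rw [simpleUnit_apply, h3]
  refine sub_eq_zero.1 ?_
  refine ρ.eq_zero_of_comp_simpleπ c π R hR _ fun q i => ?_
  change (f' ≫ ρ.inductionUnit R hR (ρ.projRepTensor c π) - f) ≫
    ρ.inductionπ R hR (ρ.projRepTensor c π) q ≫ (ρ.F (R q)).map (ρ.repCoord c π i) = 0
  by_cases hq : q = (1 : G)
  · subst hq
    have h4 : (f' ≫ ρ.inductionUnit R hR (ρ.projRepTensor c π) - f) ≫
        ρ.inductionπ R hR (ρ.projRepTensor c π) (1 : G) = 0 := by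
      rw [← cancel_mono θ.inv]
      simp only [Preadditive.sub_comp, Category.assoc, hθ', zero_comp, Category.comp_id]
      exact sub_self _
    rw [reassoc_of% h4, zero_comp]
  -- A nonzero coordinate would be an isomorphism from `U` to ρ^{R(q)}(U), putting `R q` in G_U and
  -- making the coset trivial.
  · by_contra h
    have := isIso_of_hom_simple h
    apply hq
    rw [← hR q]
    refine QuotientGroup.eq.2 ?_
    rw [mul_one]
    exact (ρ.inertia U).inv_mem ⟨(asIso ((f' ≫ ρ.inductionUnit R hR (ρ.projRepTensor c π) - f) ≫
      ρ.inductionπ R hR (ρ.projRepTensor c π) q ≫ (ρ.F (R q)).map (ρ.repCoord c π i))).symm⟩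

variable [MonoidalCategory C] [MonoidalPreadditive C] [MonoidalLinear k C] [RigidCategory C]
  [IsFusionCategory k C]

/-- An equivariant object without morphisms from `U` has no nonzero morphism to `S_{U,π}`. -/
theorem hom_simpleObject_eq_zero {X : EquivariantObject ρ} (hX : ∀ f : U ⟶ X.obj, f = 0)
    (f : X.obj ⟶ (ρ.simpleObject c R hR π).obj) : f = 0 := by
  have key : ∀ (g : G) (a : X.obj ⟶ (ρ.F g).obj U), a = 0 := by
    intro g a
    have : IsIso (X.act g) := X.isIso_act g
    -- Fullness of `ρ^g` pulls the map back to some `b` from `X` to `U`; if `b` were nonzero, its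
    -- section would be a nonzero morphism from `U` to `X`.
    obtain ⟨b, hb⟩ := (ρ.F g).map_surjective (X.act g ≫ a)
    have hb0 : b = 0 := by
      by_contra h
      obtain ⟨s, hs⟩ := exists_section_of_ne_zero k b h
      rw [hX s, zero_comp] at hs
      exact id_nonzero U hs.symm
    rw [hb0, Functor.map_zero] at hb
    rw [← cancel_epi (X.act g), ← hb, comp_zero]
  exact ρ.eq_zero_of_comp_simpleπ c π R hR f fun q i => key _ _

/-- The object `S_{U,π}` is simple if `π` is irreducible. -/
theorem simple_simpleObject (hπ : π.IsIrreducible) : Simple (ρ.simpleObject c R hR π) := by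
  constructor
  intro X f hf
  constructor
  · rintro hiso rfl
    have hid : 𝟙 (ρ.simpleObject c R hR π) = 0 := by
      rw [← cancel_epi (0 : X ⟶ ρ.simpleObject c R hR π), zero_comp, zero_comp]
    have hid' : 𝟙 (ρ.simpleObject c R hR π).obj = 0 := congrArg EquivariantObject.Hom.hom hid
    obtain ⟨v, hv⟩ := @exists_ne V hπ.1 0
    obtain ⟨i, hi⟩ : ∃ i, (Module.finBasis k V).repr v i ≠ 0 := by
      by_contra! h
      exact hv ((Module.finBasis k V).repr.map_eq_zero_iff.1 (Finsupp.ext h))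
    have h1 := ρ.simpleι_π_self c π R hR (1 : G) v i
    rw [← Category.comp_id (ρ.simpleι c π R hR (1 : G) v), hid', comp_zero, zero_comp] at h1
    exact (smul_ne_zero hi (id_nonzero _)) h1.symm
  · intro h0
    have hmono : Mono f.hom := EquivariantObject.mono_hom_of_mono f
    -- `W` consists of the vectors whose morphism U → S_{U,π} factors through the subobject;
    -- irreducibility leaves only two cases.
    let W : Submodule k V := (LinearMap.range (Linear.rightComp k U f.hom)).comap
      (ρ.simpleUnit c π R hR)
    rcases hπ.2 W (by
      rintro g v ⟨a, ha⟩
      refine ⟨ρ.homAct c X g a, ?_⟩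
      rw [← homAct_simpleUnit, ← ha]
      exact (ρ.homAct_comp_hom c f g a).symm) with hW | hW
    -- If `W = 0`, then `X` receives no nonzero morphism from `U`, since every morphism from `U` to
    -- S_{U,π} comes from `V`.
    · refine absurd ?_ h0
      apply EquivariantObject.hom_ext
      refine ρ.hom_simpleObject_eq_zero c π R hR (fun a => ?_) f.hom
      obtain ⟨v, hv⟩ := ρ.simpleUnit_surjective c π R hR (a ≫ f.hom)
      have hvW : v ∈ W := ⟨a, hv.symm⟩
      rw [hW, Submodule.mem_bot] at hvW
      rw [← cancel_mono f.hom, zero_comp, ← hv, hvW, map_zero]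
    -- If `W = V`, the unit lifts to an intertwiner into Hom(U, X), and reciprocity turns this lift
    -- into a section of the monomorphism `f`.
    · let incl : (U ⟶ X.obj) →ₗ[k] (U ⟶ (ρ.simpleObject c R hR π).obj) :=
        Linear.rightComp k U f.hom
      have hinj : Function.Injective incl := fun a b h => (cancel_mono f.hom).1 h
      have hmem : ∀ v, ∃ a, a ≫ f.hom = ρ.simpleUnit c π R hR v := fun v => by
        have : v ∈ W := hW ▸ Submodule.mem_top
        exact this
      let φ : V →ₗ[k] (U ⟶ X.obj) :=
        (LinearEquiv.ofInjective incl hinj).symm.toLinearMap ∘ₗ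
          (ρ.simpleUnit c π R hR).codRestrict (LinearMap.range incl) hmem
      have hφ : ∀ v, φ v ≫ f.hom = ρ.simpleUnit c π R hR v := fun v =>
        congrArg Subtype.val ((LinearEquiv.ofInjective incl hinj).apply_symm_apply
          ((ρ.simpleUnit c π R hR).codRestrict (LinearMap.range incl) hmem v))
      obtain ⟨s, hs⟩ := ρ.exists_simpleObject_hom c π R hR φ fun g v => by
        rw [← cancel_mono f.hom, ← homAct_comp_hom, hφ, hφ, homAct_simpleUnit]
      have hsf : s ≫ f = 𝟙 _ := by
        refine ρ.simpleObject_hom_ext c π R hR fun v => ?_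
        rw [EquivariantObject.comp_hom, ← Category.assoc, hs, hφ]
        exact (Category.comp_id _).symm
      refine ⟨s, ?_, hsf⟩
      rw [← cancel_mono f, Category.assoc, hsf, Category.comp_id, Category.id_comp]

end LinearAction

/-! ### Averaging over a projective representation. -/

namespace ProjRep

variable {k : Type*} [Field k] {H : Type*} [Group H] [Fintype H] {V W : Type*} [AddCommGroup V]
  [Module k V] [AddCommGroup W] [Module k W] {α : H → H → k}

/-- The average of a linear map over a projective representation. -/
def average (δ : ProjRep α V) (B : H → W →ₗ[k] W) (M : V →ₗ[k] W) : V →ₗ[k] W :=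
  ∑ g, B g ∘ₗ M ∘ₗ (δ.toFun g).symm.toLinearMap

theorem average_apply (δ : ProjRep α V) (B : H → W →ₗ[k] W) (M : V →ₗ[k] W) (v : V) :
    δ.average B M v = ∑ g, B g (M ((δ.toFun g).symm v)) := by
  simp [average]

/-- The average is an intertwiner. -/
theorem apply_average (δ : ProjRep α V) (B : H → W →ₗ[k] W)
    (hB : ∀ g h, B g ∘ₗ B h = α g h • B (g * h)) (M : V →ₗ[k] W) (x : H) (v : V) :
    B x (δ.average B M v) = δ.average B M (δ.toFun x v) := by
  rw [average_apply, average_apply, map_sum, ← Equiv.sum_comp (Equiv.mulLeft x) fun g =>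
    B g (M ((δ.toFun g).symm (δ.toFun x v)))]
  refine Finset.sum_congr rfl fun g _ => ?_
  -- After the substitution g ↦ xg, this scalar must match the one produced by `hB`; this is where
  -- the equality of the two factor sets enters.
  have h1 : δ.toFun x v = α x g • δ.toFun (x * g) ((δ.toFun g).symm v) := by
    have := LinearMap.congr_fun (δ.mul x g) ((δ.toFun g).symm v)
    simpa using this
  rw [Equiv.coe_mulLeft, h1, map_smul, LinearEquiv.symm_apply_apply, map_smul, map_smul]
  exact LinearMap.congr_fun (hB x g) _

end ProjRep

/-! ### How the group moves the summands of S_{U,π}. -/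

namespace LinearAction

/-- Makes T the stabiliser in G_U of a pair of cosets. -/
theorem mem_conj_iff {G : Type*} [Group G] {H : Subgroup G} (R : G ⧸ H → G) (hR : ∀ q, (R q : G ⧸ H) = q) (q : G ⧸ H)
    (g : G) : g ∈ conj (R q) H ↔ g • q = q := by
  have h1 : g • q = ((g * R q : G) : G ⧸ H) := by
    conv_lhs => rw [← hR q]
    rfl
  rw [h1]
  conv_rhs => rw [eq_comm]; lhs; rw [← hR q]
  rw [QuotientGroup.eq, ← mul_assoc]
  rfl

variable {k : Type*} [Field k] {G : Type*} [Group G] {C : Type u} [Category.{v} C]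
  [Abelian C] [Linear k C] (ρ : LinearAction k G C) {U : C} (c : ρ.InertiaIsos U)
  [IsAlgClosed k] [Simple U] [FiniteDimensional k (U ⟶ U)]
  {V : Type*} [AddCommGroup V] [Module k V] [FiniteDimensional k V]
  (π : ProjRep (ρ.factorSet c) V)
  [Finite G] (R : G ⧸ ρ.inertia U → G) (hR : ∀ q, (R q : G ⧸ ρ.inertia U) = q)

theorem map_simpleι_act {q q' : G ⧸ ρ.inertia U} {g : G} {h : ρ.inertia U}
    (e : R q' * (h : G) = g * R q) (v : V) :
    (ρ.F g).map (ρ.simpleι c π R hR q v) ≫ (ρ.simpleObject c R hR π).act g =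
      ρ.component e (c h).hom ≫ ρ.simpleι c π R hR q' (π.toFun h v) := by
  change (ρ.F g).map ((ρ.F (R q)).map (ρ.repElem c π v) ≫
      ρ.inductionι R hR (ρ.projRepTensor c π) q) ≫
        (ρ.induction R hR (ρ.projRepTensor c π)).act g = _ ≫
    (ρ.F (R q')).map (ρ.repElem c π (π.toFun h v)) ≫ ρ.inductionι R hR (ρ.projRepTensor c π) q'
  rw [Functor.map_comp, Category.assoc, map_inductionι_act, ρ.leg_congr R hR _ _ e, leg,
    reassoc_of% ρ.mulApp_naturality, reassoc_of% ρ.mulApp_inv_naturality, ← Functor.map_comp_assoc,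
    map_repElem_comp_restrictAct, LinearAction.component, mul_hom_app, mulIso_inv_app,
    Functor.map_comp]
  simp only [Category.assoc]

/-- For `g` fixing the coset, the component of the equivariant structure is the conjugate
isomorphism ᵗc used in τ. -/
theorem map_simpleι_act_of_mem_conj (q : G ⧸ ρ.inertia U) (g : conj (R q) (ρ.inertia U)) (v : V) :
    (ρ.F g).map (ρ.simpleι c π R hR q v) ≫ (ρ.simpleObject c R hR π).act g =
      (ρ.conjIso c (R q) g).hom ≫
        ρ.simpleι c π R hR q ((π.comap (conjHom (R q) _)).toFun g v) :=
  ρ.map_simpleι_act c π R hR (h := conjHom (R q) _ g)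
    (show R q * ((R q)⁻¹ * g * R q) = g * R q by group) v

theorem map_simpleι_act_π_ne {q q' : G ⧸ ρ.inertia U} {g : G} (h : g • q ≠ q') (v : V)
    (i : Fin (Module.finrank k V)) :
    ((ρ.F g).map (ρ.simpleι c π R hR q v) ≫ (ρ.simpleObject c R hR π).act g) ≫
      ρ.simpleπ c π R hR q' i = 0 := by
  rw [ρ.map_simpleι_act c π R hR (cosetElement_spec R hR g q), Category.assoc,
    simpleι_π_ne _ _ _ _ _ h, comp_zero]

end LinearAction

/-! ### Block decomposition of Hom_C(U, S_{Y,π} ⊗ S_{Z,γ}). -/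

namespace TensorAction

open LinearAction

section

variable {k : Type*} [Field k] {G : Type*} [Group G] {C : Type u} [Category.{v} C] [Abelian C]
  [Linear k C] [MonoidalCategory C] (ρ : TensorAction k G C) {U : C} (cU : ρ.InertiaIsos U)
  (A B : EquivariantObject ρ.toLinearAction)

/-- The operator of `g ∈ G_U` on `Hom_C(U, A ⊗ B)` for equivariant objects `A`, `B`. -/
def tensorHomAct (g : ρ.inertia U) : (U ⟶ A.obj ⊗ B.obj) →ₗ[k] (U ⟶ A.obj ⊗ B.obj) :=
  ρ.homAct cU (ρ.tensorObj A B) g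

theorem tensorHomAct_apply (g : ρ.inertia U) (f : U ⟶ A.obj ⊗ B.obj) :
    ρ.tensorHomAct cU A B g f = (cU g).inv ≫ (ρ.F g).map f ≫
      Functor.OplaxMonoidal.δ (ρ.F g) A.obj B.obj ≫ (A.act g ⊗ₘ B.act g) := rfl

theorem smul_tensor_smul [MonoidalPreadditive C] [MonoidalLinear k C] {P P' Q Q' : C} (a b : k)
    (x : P ⟶ P') (y : Q ⟶ Q') : (a • x ⊗ₘ b • y) = (a * b) • (x ⊗ₘ y) := by
  rw [MonoidalCategory.tensorHom_def, MonoidalCategory.tensorHom_def,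
    MonoidalLinear.smul_whiskerRight, MonoidalLinear.whiskerLeft_smul, Linear.smul_comp,
    Linear.comp_smul, smul_smul]

theorem comp_tensorHom_comp {P Q S A A' A'' B B' B'' : C} (c : P ⟶ Q) (f : Q ⟶ S) (d : S ⟶ A ⊗ B)
    (a : A ⟶ A') (a' : A' ⟶ A'') (b : B ⟶ B') (b' : B' ⟶ B'') :
    c ≫ f ≫ d ≫ (a ≫ a' ⊗ₘ b ≫ b') = (c ≫ f ≫ d ≫ (a ⊗ₘ b)) ≫ (a' ⊗ₘ b') := by
  simp only [Category.assoc, tensorHom_comp_tensorHom]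

theorem smul_tensorHom [MonoidalPreadditive C] [MonoidalLinear k C] {P P' Q Q' : C} (a : k)
    (x : P ⟶ P') (y : Q ⟶ Q') : (a • x ⊗ₘ y) = a • (x ⊗ₘ y) := by
  simpa using smul_tensor_smul a 1 x y

theorem tensorHom_smul [MonoidalPreadditive C] [MonoidalLinear k C] {P P' Q Q' : C} (a : k)
    (x : P ⟶ P') (y : Q ⟶ Q') : (x ⊗ₘ a • y) = a • (x ⊗ₘ y) := by
  simpa using smul_tensor_smul 1 a x y

end

variable {k : Type*} [Field k] [IsAlgClosed k] {G : Type*} [Group G] [Finite G] {C : Type u}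
  [Category.{v} C] [Abelian C] [Linear k C] [MonoidalCategory C] [MonoidalPreadditive C]
  [MonoidalLinear k C] (ρ : TensorAction k G C) {U Y Z : C} [Simple U] [Simple Y] [Simple Z]
  [FiniteDimensional k (U ⟶ U)] [FiniteDimensional k (Y ⟶ Y)] [FiniteDimensional k (Z ⟶ Z)]
  (cU : ρ.InertiaIsos U) (cY : ρ.InertiaIsos Y) (cZ : ρ.InertiaIsos Z)
  {VY VZ : Type*} [AddCommGroup VY] [Module k VY] [FiniteDimensional k VY]
  [AddCommGroup VZ] [Module k VZ] [FiniteDimensional k VZ]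
  (π : ProjRep (ρ.factorSet cY) VY) (γ : ProjRep (ρ.factorSet cZ) VZ)
  (RY : G ⧸ ρ.inertia Y → G) (hRY : ∀ q, (RY q : G ⧸ ρ.inertia Y) = q)
  (RZ : G ⧸ ρ.inertia Z → G) (hRZ : ∀ q, (RZ q : G ⧸ ρ.inertia Z) = q)

/-- `Hom_C(U, ρ^t(Y) ⊗ ρ^s(Z))` for the representatives `t`, `s` of two cosets. -/
abbrev FusionHom (U : C) (q : G ⧸ ρ.inertia Y) (r : G ⧸ ρ.inertia Z) : Type v :=
  U ⟶ (ρ.F (RY q)).obj Y ⊗ (ρ.F (RZ r)).obj Z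

/-- The inclusion of `V_π ⊗ V_γ ⊗ Hom_C(U, ρ^t(Y) ⊗ ρ^s(Z))` into
`Hom_C(U, S_{Y,π} ⊗ S_{Z,γ})`. -/
def fusionι (U : C) (q : G ⧸ ρ.inertia Y) (r : G ⧸ ρ.inertia Z) :
    TensorProduct k VY (TensorProduct k VZ (ρ.FusionHom RY RZ U q r)) →ₗ[k]
      (U ⟶ (ρ.simpleObject cY RY hRY π).obj ⊗ (ρ.simpleObject cZ RZ hRZ γ).obj) :=
  TensorProduct.lift (TensorProduct.uncurry (RingHom.id k) _ _ _ ∘ₗ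
    LinearMap.mk₂ k (fun v w => Linear.rightComp k U
      (ρ.simpleι cY π RY hRY q v ⊗ₘ ρ.simpleι cZ γ RZ hRZ r w))
    (fun v v' w => by ext f; simp [MonoidalPreadditive.add_tensor])
    (fun a v w => by ext f; simp [smul_tensorHom])
    (fun v w w' => by ext f; simp [MonoidalPreadditive.tensor_add])
    (fun a v w => by ext f; simp [tensorHom_smul]))

theorem fusionι_tmul (U : C) (q : G ⧸ ρ.inertia Y) (r : G ⧸ ρ.inertia Z) (v : VY) (w : VZ)
    (f : ρ.FusionHom RY RZ U q r) :
    ρ.fusionι cY cZ π γ RY hRY RZ hRZ U q r (v ⊗ₜ (w ⊗ₜ f)) =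
      f ≫ (ρ.simpleι cY π RY hRY q v ⊗ₘ ρ.simpleι cZ γ RZ hRZ r w) := rfl

/-- The projection of `Hom_C(U, S_{Y,π} ⊗ S_{Z,γ})` to
`V_π ⊗ V_γ ⊗ Hom_C(U, ρ^t(Y) ⊗ ρ^s(Z))`. -/
def fusionπ (U : C) (q : G ⧸ ρ.inertia Y) (r : G ⧸ ρ.inertia Z) :
    (U ⟶ (ρ.simpleObject cY RY hRY π).obj ⊗ (ρ.simpleObject cZ RZ hRZ γ).obj) →ₗ[k]
      TensorProduct k VY (TensorProduct k VZ (ρ.FusionHom RY RZ U q r)) :=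
  ∑ i, ∑ j, TensorProduct.mk k _ _ (Module.finBasis k VY i) ∘ₗ
    TensorProduct.mk k _ _ (Module.finBasis k VZ j) ∘ₗ
      Linear.rightComp k U (ρ.simpleπ cY π RY hRY q i ⊗ₘ ρ.simpleπ cZ γ RZ hRZ r j)

theorem fusionπ_apply (q : G ⧸ ρ.inertia Y) (r : G ⧸ ρ.inertia Z)
    (f : U ⟶ (ρ.simpleObject cY RY hRY π).obj ⊗ (ρ.simpleObject cZ RZ hRZ γ).obj) :
    ρ.fusionπ cY cZ π γ RY hRY RZ hRZ U q r f = ∑ i, ∑ j, Module.finBasis k VY i ⊗ₜ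
      (Module.finBasis k VZ j ⊗ₜ
        (f ≫ (ρ.simpleπ cY π RY hRY q i ⊗ₘ ρ.simpleπ cZ γ RZ hRZ r j))) := by
  simp [fusionπ]

/-- Each block is a direct summand: coordinates of v ⊗ id and w ⊗ id are scalars, and they
reassemble `v` and `w` from the bases. -/
theorem fusionπ_fusionι (q : G ⧸ ρ.inertia Y) (r : G ⧸ ρ.inertia Z)
    (x : TensorProduct k VY (TensorProduct k VZ (ρ.FusionHom RY RZ U q r))) :
    ρ.fusionπ cY cZ π γ RY hRY RZ hRZ U q r (ρ.fusionι cY cZ π γ RY hRY RZ hRZ U q r x) = x := by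
  suffices h : ρ.fusionπ cY cZ π γ RY hRY RZ hRZ U q r ∘ₗ
      ρ.fusionι cY cZ π γ RY hRY RZ hRZ U q r = LinearMap.id from LinearMap.congr_fun h x
  refine TensorProduct.ext' fun v y => ?_
  induction y with
  | zero => simp
  | add y y' hy hy' => rw [TensorProduct.tmul_add, map_add, map_add, hy, hy']
  | tmul w f =>
    rw [LinearMap.comp_apply, fusionι_tmul, fusionπ_apply, LinearMap.id_apply]
    conv_rhs => rw [← (Module.finBasis k VY).sum_repr v, ← (Module.finBasis k VZ).sum_repr w]
    rw [TensorProduct.sum_tmul]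
    refine Finset.sum_congr rfl fun i _ => ?_
    rw [TensorProduct.sum_tmul, TensorProduct.tmul_sum]
    refine Finset.sum_congr rfl fun j _ => ?_
    rw [Category.assoc, tensorHom_comp_tensorHom, simpleι_π_self, simpleι_π_self,
      smul_tensor_smul, id_tensorHom_id,
      Linear.comp_smul, Category.comp_id]
    simp only [TensorProduct.tmul_smul, ← TensorProduct.smul_tmul', smul_smul]
    rw [mul_comm]

/-- The blocks exhaust the Hom space: expand the identities of both factors in coordinates and use
additivity of ⊗ in each variable. -/
theorem sum_fusionι_fusionπ [Fintype (G ⧸ ρ.inertia Y)] [Fintype (G ⧸ ρ.inertia Z)]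
    (f : U ⟶ (ρ.simpleObject cY RY hRY π).obj ⊗ (ρ.simpleObject cZ RZ hRZ γ).obj) :
    ∑ q, ∑ r, ρ.fusionι cY cZ π γ RY hRY RZ hRZ U q r
      (ρ.fusionπ cY cZ π γ RY hRY RZ hRZ U q r f) = f := by
  have h1 := congrArg₂ (fun a b => f ≫ (a ⊗ₘ b)) (ρ.sum_simpleπ_ι cY π RY hRY)
    (ρ.sum_simpleπ_ι cZ γ RZ hRZ)
  simp only [id_tensorHom_id, Category.comp_id] at h1
  conv_rhs => rw [← h1]
  simp only [fusionπ_apply, map_sum, fusionι_tmul, sum_tensor, tensor_sum, Preadditive.comp_sum,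
    Category.assoc, tensorHom_comp_tensorHom]
  rw [Finset.sum_comm]
  refine Finset.sum_congr rfl fun r _ => ?_
  conv_rhs => rw [Finset.sum_comm]
  exact Finset.sum_congr rfl fun q _ => Finset.sum_comm

/-- Naturality of the monoidal structure of `ρ^g` separates the two factors, so each S can be
treated on its own. -/
theorem tensorHomAct_fusionι_tmul (q : G ⧸ ρ.inertia Y) (r : G ⧸ ρ.inertia Z) (g : ρ.inertia U)
    (v : VY) (w : VZ) (f : ρ.FusionHom RY RZ U q r) :
    ρ.tensorHomAct cU (ρ.simpleObject cY RY hRY π) (ρ.simpleObject cZ RZ hRZ γ) g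
      (ρ.fusionι cY cZ π γ RY hRY RZ hRZ U q r (v ⊗ₜ (w ⊗ₜ f))) =
    (cU g).inv ≫ (ρ.F g).map f ≫ Functor.OplaxMonoidal.δ (ρ.F g) _ _ ≫
      (((ρ.F g).map (ρ.simpleι cY π RY hRY q v) ≫ (ρ.simpleObject cY RY hRY π).act g) ⊗ₘ
        ((ρ.F g).map (ρ.simpleι cZ γ RZ hRZ r w) ≫ (ρ.simpleObject cZ RZ hRZ γ).act g)) := by
  rw [fusionι_tmul, tensorHomAct_apply, Functor.map_comp, Category.assoc,
    ← Functor.OplaxMonoidal.δ_natural_assoc, tensorHom_comp_tensorHom]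

/-- `V_π ⊗ V_γ ⊗ Hom_C(U, ρ^t(Y) ⊗ ρ^s(Z)) → Hom_C(U, S_{Y,π} ⊗ S_{Z,γ})` is `T`-equivariant. -/
theorem tensorHomAct_fusionι (q : G ⧸ ρ.inertia Y) (r : G ⧸ ρ.inertia Z)
    (g : ρ.fusionStabilizer U Y Z (RY q) (RZ r))
    (x : TensorProduct k VY (TensorProduct k VZ (ρ.FusionHom RY RZ U q r))) :
    ρ.tensorHomAct cU (ρ.simpleObject cY RY hRY π) (ρ.simpleObject cZ RZ hRZ γ)
      (ρ.toInertia U Y Z (RY q) (RZ r) g) (ρ.fusionι cY cZ π γ RY hRY RZ hRZ U q r x) =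
    ρ.fusionι cY cZ π γ RY hRY RZ hRZ U q r
      ((((π.comap (conjHom (RY q) _)).comap (ρ.toConjLeft U Y Z (RY q) (RZ r))).tensor
        (((γ.comap (conjHom (RZ r) _)).comap (ρ.toConjRight U Y Z (RY q) (RZ r))).tensor
          (ρ.tau cU cY cZ (RY q) (RZ r)))).toFun g x) := by
  induction x with
  | zero => simp only [map_zero]
  | add x x' hx hx' => simp only [map_add, hx, hx']
  | tmul v y =>
    induction y with
    | zero => simp only [TensorProduct.tmul_zero, map_zero]
    | add y y' hy hy' => simp only [TensorProduct.tmul_add, map_add, hy, hy']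
    | tmul w f =>
      refine (ρ.tensorHomAct_fusionι_tmul cU cY cZ π γ RY hRY RZ hRZ q r _ v w f).trans ?_
      have hY := ρ.map_simpleι_act_of_mem_conj cY π RY hRY q
        (ρ.toConjLeft U Y Z (RY q) (RZ r) g) v
      have hZ := ρ.map_simpleι_act_of_mem_conj cZ γ RZ hRZ r
        (ρ.toConjRight U Y Z (RY q) (RZ r) g) w
      refine (congrArg₂ (fun a b => (cU (ρ.toInertia U Y Z (RY q) (RZ r) g)).inv ≫
        (ρ.F g).map f ≫ Functor.OplaxMonoidal.δ (ρ.F g) _ _ ≫ (a ⊗ₘ b)) hY hZ).trans ?_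
      -- The factors other than π(h)v and γ(h')w are, by definition, the operator of τ applied to
      -- `f`.
      change _ = ρ.tauMap cU cY cZ (RY q) (RZ r) g f ≫
        (ρ.simpleι cY π RY hRY q ((π.comap (conjHom (RY q) _)).toFun
          (ρ.toConjLeft U Y Z (RY q) (RZ r) g) v) ⊗ₘ
        ρ.simpleι cZ γ RZ hRZ r ((γ.comap (conjHom (RZ r) _)).toFun
          (ρ.toConjRight U Y Z (RY q) (RZ r) g) w))
      exact comp_tensorHom_comp _ _ _ _ _ _ _

/-- The operator of `g` carries the block of (q, r) into that of (gq, gr), so it has no component in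
any other block. -/
theorem fusionπ_tensorHomAct_fusionι_eq_zero {q q' : G ⧸ ρ.inertia Y} {r r' : G ⧸ ρ.inertia Z}
    {g : ρ.inertia U} (h : ¬((g : G) • q = q' ∧ (g : G) • r = r'))
    (x : TensorProduct k VY (TensorProduct k VZ (ρ.FusionHom RY RZ U q r))) :
    ρ.fusionπ cY cZ π γ RY hRY RZ hRZ U q' r'
      (ρ.tensorHomAct cU (ρ.simpleObject cY RY hRY π) (ρ.simpleObject cZ RZ hRZ γ) g
        (ρ.fusionι cY cZ π γ RY hRY RZ hRZ U q r x)) = 0 := by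
  induction x with
  | zero => simp only [map_zero]
  | add x x' hx hx' => simp only [map_add, hx, hx', add_zero]
  | tmul v y =>
    induction y with
    | zero => simp only [TensorProduct.tmul_zero, map_zero]
    | add y y' hy hy' => simp only [TensorProduct.tmul_add, map_add, hy, hy', add_zero]
    | tmul w f =>
      rw [tensorHomAct_fusionι_tmul, fusionπ_apply]
      refine Finset.sum_eq_zero fun i _ => Finset.sum_eq_zero fun j _ => ?_
      rw [Category.assoc, Category.assoc, Category.assoc, tensorHom_comp_tensorHom]
      rcases not_and_or.1 h with h | h
      · rw [ρ.map_simpleι_act_π_ne cY π RY hRY h, MonoidalPreadditive.zero_tensor]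
        simp only [comp_zero, TensorProduct.tmul_zero]
      · rw [ρ.map_simpleι_act_π_ne cZ γ RZ hRZ h, MonoidalPreadditive.tensor_zero]
        simp only [comp_zero, TensorProduct.tmul_zero]

end TensorAction

/-- Finite dimension matters: `finrank` is also `0` on infinite-dimensional spaces. -/
theorem ProjRep.multiplicity_ne_zero_iff {k : Type*} [Field k] {G : Type*} [Group G]
    {V W : Type*} [AddCommGroup V] [Module k V] [AddCommGroup W] [Module k W]
    [FiniteDimensional k V] [FiniteDimensional k W] {α β : G → G → k} (π : ProjRep α V)
    (σ : ProjRep β W) :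
    π.multiplicity σ ≠ 0 ↔
      ∃ φ : V →ₗ[k] W, φ ≠ 0 ∧ ∀ g v, φ (π.toFun g v) = σ.toFun g (φ v) := by
  rw [multiplicity, ne_eq, Submodule.finrank_eq_zero, ← ne_eq, Submodule.ne_bot_iff]
  constructor
  · rintro ⟨φ, hφ, h0⟩
    exact ⟨φ, h0, fun g v => LinearMap.congr_fun (hφ g) v⟩
  · rintro ⟨φ, h0, hφ⟩
    exact ⟨φ, fun g => LinearMap.ext (hφ g), h0⟩

/-! ### Mackey's argument: from intertwiners for G_U to intertwiners for T and back. -/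

namespace TensorAction

open LinearAction

variable {k : Type*} [Field k] [IsAlgClosed k] {G : Type*} [Group G] [Finite G] {C : Type u}
  [Category.{v} C] [Abelian C] [Linear k C] [MonoidalCategory C] [MonoidalPreadditive C]
  [MonoidalLinear k C] (ρ : TensorAction k G C) {U Y Z : C} [Simple U] [Simple Y] [Simple Z]
  [FiniteDimensional k (U ⟶ U)] [FiniteDimensional k (Y ⟶ Y)] [FiniteDimensional k (Z ⟶ Z)]
  (cU : ρ.InertiaIsos U) (cY : ρ.InertiaIsos Y) (cZ : ρ.InertiaIsos Z)
  {VU VY VZ : Type*} [AddCommGroup VU] [Module k VU]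
  [AddCommGroup VY] [Module k VY] [FiniteDimensional k VY]
  [AddCommGroup VZ] [Module k VZ] [FiniteDimensional k VZ]
  (δ : ProjRep (ρ.factorSet cU) VU) (π : ProjRep (ρ.factorSet cY) VY)
  (γ : ProjRep (ρ.factorSet cZ) VZ)
  (RY : G ⧸ ρ.inertia Y → G) (hRY : ∀ q, (RY q : G ⧸ ρ.inertia Y) = q)
  (RZ : G ⧸ ρ.inertia Z → G) (hRZ : ∀ q, (RZ q : G ⧸ ρ.inertia Z) = q)

/-- The projective representation `ᵗπ ⊗ ˢγ ⊗ τ_U^{t,s}(Y,Z)` of `T`. -/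
abbrev fusionRep (q : G ⧸ ρ.inertia Y) (r : G ⧸ ρ.inertia Z) :=
  (((π.comap (conjHom (RY q) _)).comap (ρ.toConjLeft U Y Z (RY q) (RZ r))).tensor
    (((γ.comap (conjHom (RZ r) _)).comap (ρ.toConjRight U Y Z (RY q) (RZ r))).tensor
      (ρ.tau cU cY cZ (RY q) (RZ r))))

/-- The projection to `V_π ⊗ V_γ ⊗ Hom_C(U, ρ^t(Y) ⊗ ρ^s(Z))` is `T`-equivariant. -/
theorem fusionπ_tensorHomAct (q : G ⧸ ρ.inertia Y) (r : G ⧸ ρ.inertia Z)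
    (g : ρ.fusionStabilizer U Y Z (RY q) (RZ r))
    (f : U ⟶ (ρ.simpleObject cY RY hRY π).obj ⊗ (ρ.simpleObject cZ RZ hRZ γ).obj) :
    ρ.fusionπ cY cZ π γ RY hRY RZ hRZ U q r
      (ρ.tensorHomAct cU (ρ.simpleObject cY RY hRY π) (ρ.simpleObject cZ RZ hRZ γ)
        (ρ.toInertia U Y Z (RY q) (RZ r) g) f) =
      (ρ.fusionRep cU cY cZ π γ RY RZ q r).toFun g
        (ρ.fusionπ cY cZ π γ RY hRY RZ hRZ U q r f) := by
  have := Fintype.ofFinite (G ⧸ ρ.inertia Y)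
  have := Fintype.ofFinite (G ⧸ ρ.inertia Z)
  have hq : ((ρ.toInertia U Y Z (RY q) (RZ r) g : ρ.inertia U) : G) • q = q :=
    (mem_conj_iff RY hRY q _).1 g.2.1.2
  have hr : ((ρ.toInertia U Y Z (RY q) (RZ r) g : ρ.inertia U) : G) • r = r :=
    (mem_conj_iff RZ hRZ r _).1 g.2.2
  conv_lhs => rw [← ρ.sum_fusionι_fusionπ cY cZ π γ RY hRY RZ hRZ f]
  simp only [map_sum]
  -- `g` fixes `q` and `r` and permutes cosets injectively, so no other block contributes.
  rw [Finset.sum_eq_single q, Finset.sum_eq_single r, tensorHomAct_fusionι, fusionπ_fusionι]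
  · intro r' _ h
    exact ρ.fusionπ_tensorHomAct_fusionι_eq_zero cU cY cZ π γ RY hRY RZ hRZ
      (fun h' => h ((smul_left_cancel_iff _).1 (h'.2.trans hr.symm))) _
  · exact fun h => absurd (Finset.mem_univ _) h
  · intro q' _ h
    exact Finset.sum_eq_zero fun r' _ =>
      ρ.fusionπ_tensorHomAct_fusionι_eq_zero cU cY cZ π γ RY hRY RZ hRZ
        (fun h' => h ((smul_left_cancel_iff _).1 (h'.1.trans hq.symm))) _
  · exact fun h => absurd (Finset.mem_univ _) h

/-- In the average over G_U, an element outside T moves the block away and contributes nothing,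
while each element of T returns `φ v`. -/
theorem fusionπ_average [Fintype (ρ.inertia U)] (q : G ⧸ ρ.inertia Y) (r : G ⧸ ρ.inertia Z)
    (φ : VU →ₗ[k] TensorProduct k VY (TensorProduct k VZ (ρ.FusionHom RY RZ U q r)))
    (hφ : ∀ g v, φ ((δ.comap (ρ.toInertia U Y Z (RY q) (RZ r))).toFun g v) =
      (ρ.fusionRep cU cY cZ π γ RY RZ q r).toFun g (φ v)) :
    ∃ n : ℕ, n ≠ 0 ∧ ∀ v, ρ.fusionπ cY cZ π γ RY hRY RZ hRZ U q r (δ.average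
      (ρ.tensorHomAct cU (ρ.simpleObject cY RY hRY π) (ρ.simpleObject cZ RZ hRZ γ))
      (ρ.fusionι cY cZ π γ RY hRY RZ hRZ U q r ∘ₗ φ) v) = n • φ v := by
  classical
  -- This number is the order of T; it is nonzero because the identity is counted.
  refine ⟨(Finset.univ.filter fun g : ρ.inertia U => (g : G) • q = q ∧ (g : G) • r = r).card,
    ?_, fun v => ?_⟩
  · exact Finset.card_ne_zero_of_mem (a := 1) (by simp)
  · rw [ProjRep.average_apply, map_sum, ← Finset.sum_const, Finset.sum_filter]
    refine Finset.sum_congr rfl fun g _ => ?_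
    split_ifs with h
    · have hT : (g : G) ∈ ρ.fusionStabilizer U Y Z (RY q) (RZ r) :=
        ⟨⟨g.2, (mem_conj_iff RY hRY q _).2 h.1⟩, (mem_conj_iff RZ hRZ r _).2 h.2⟩
      have h1 := ρ.tensorHomAct_fusionι cU cY cZ π γ RY hRY RZ hRZ q r ⟨g, hT⟩
        (φ ((δ.toFun g).symm v))
      rw [← hφ] at h1
      have h2 : (δ.comap (ρ.toInertia U Y Z (RY q) (RZ r))).toFun ⟨g, hT⟩
          ((δ.toFun g).symm v) = v := (δ.toFun g).apply_symm_apply v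
      rw [h2] at h1
      exact (congrArg _ h1).trans (ρ.fusionπ_fusionι cY cZ π γ RY hRY RZ hRZ q r _)
    · exact ρ.fusionπ_tensorHomAct_fusionι_eq_zero cU cY cZ π γ RY hRY RZ hRZ h _

/-- Intertwiners `V_δ → Hom_C(U, S_{Y,π} ⊗ S_{Z,γ})` and intertwiners between projective
representations of the groups `T`. -/
theorem exists_intertwiner_tensorHomAct_iff [CharZero k] :
    (∃ φ : VU →ₗ[k] (U ⟶ (ρ.simpleObject cY RY hRY π).obj ⊗ (ρ.simpleObject cZ RZ hRZ γ).obj),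
      φ ≠ 0 ∧ ∀ g v, ρ.tensorHomAct cU _ _ g (φ v) = φ (δ.toFun g v)) ↔
    ∃ (q : G ⧸ ρ.inertia Y) (r : G ⧸ ρ.inertia Z)
      (φ : VU →ₗ[k] TensorProduct k VY (TensorProduct k VZ (ρ.FusionHom RY RZ U q r))),
      φ ≠ 0 ∧ ∀ g v, φ ((δ.comap (ρ.toInertia U Y Z (RY q) (RZ r))).toFun g v) =
        (ρ.fusionRep cU cY cZ π γ RY RZ q r).toFun g (φ v) := by
  constructor
  · rintro ⟨φ, h0, hφ⟩
    have := Fintype.ofFinite (G ⧸ ρ.inertia Y)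
    have := Fintype.ofFinite (G ⧸ ρ.inertia Z)
    -- Since the blocks span, a nonzero `φ` has a nonzero component, and that component is the
    -- required T-intertwiner.
    by_cases h : ∀ q r, ρ.fusionπ cY cZ π γ RY hRY RZ hRZ U q r ∘ₗ φ = 0
    · refine absurd (LinearMap.ext fun v => ?_) h0
      rw [← ρ.sum_fusionι_fusionπ cY cZ π γ RY hRY RZ hRZ (φ v)]
      refine Finset.sum_eq_zero fun q _ => Finset.sum_eq_zero fun r _ => ?_
      exact (congrArg _ (LinearMap.congr_fun (h q r) v)).trans (map_zero _)
    · push Not at h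
      obtain ⟨q, r, h⟩ := h
      refine ⟨q, r, _, h, fun g v => ?_⟩
      rw [LinearMap.comp_apply, LinearMap.comp_apply, ← fusionπ_tensorHomAct, hφ]
      rfl
  · rintro ⟨q, r, φ, h0, hφ⟩
    have := Fintype.ofFinite (ρ.inertia U)
    obtain ⟨n, hn, h⟩ := ρ.fusionπ_average cU cY cZ δ π γ RY hRY RZ hRZ q r φ hφ
    refine ⟨_, ?_, δ.apply_average _ (ρ.homAct_comp cU (ρ.tensorObj _ _))
      (ρ.fusionι cY cZ π γ RY hRY RZ hRZ U q r ∘ₗ φ)⟩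
    intro h1
    refine h0 (LinearMap.ext fun v => ?_)
    have h2 := h v
    -- Characteristic zero enters here: `n` stays nonzero in `k`, so a vanishing average would force
    -- `φ = 0`.
    rw [← Nat.cast_smul_eq_nsmul k] at h2
    have h3 := (map_zero _).symm.trans ((congrArg (ρ.fusionπ cY cZ π γ RY hRY RZ hRZ U q r)
      (LinearMap.congr_fun h1 v)).symm.trans h2)
    exact (smul_eq_zero.1 h3.symm).resolve_left (Nat.cast_ne_zero.2 hn)

end TensorAction

end

theorem corollary3p11 {k : Type*} [Field k] [IsAlgClosed k] [CharZero k]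
    {C : Type u} [Category.{v} C] [Abelian C] [Linear k C]
    [MonoidalCategory C] [MonoidalPreadditive C] [MonoidalLinear k C] [RigidCategory C]
    [IsFusionCategory k C] {G : Type*} [Group G] [Finite G] (ρ : TensorAction k G C)
    (U Y Z : C) [Simple U] [Simple Y] [Simple Z]
    (cU : ρ.InertiaIsos U) (cY : ρ.InertiaIsos Y) (cZ : ρ.InertiaIsos Z)
    {VU VY VZ : Type*} [AddCommGroup VU] [Module k VU] [FiniteDimensional k VU]
    [AddCommGroup VY] [Module k VY] [FiniteDimensional k VY]
    [AddCommGroup VZ] [Module k VZ] [FiniteDimensional k VZ]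
    (δ : ProjRep (ρ.factorSet cU) VU) (π : ProjRep (ρ.factorSet cY) VY)
    (γ : ProjRep (ρ.factorSet cZ) VZ)
    (hδ : δ.IsIrreducible) (hπ : π.IsIrreducible) (hγ : γ.IsIrreducible)
    (RU : G ⧸ ρ.inertia U → G) (hRU : ∀ q, (RU q : G ⧸ ρ.inertia U) = q)
    (RY : G ⧸ ρ.inertia Y → G) (hRY : ∀ q, (RY q : G ⧸ ρ.inertia Y) = q)
    (RZ : G ⧸ ρ.inertia Z → G) (hRZ : ∀ q, (RZ q : G ⧸ ρ.inertia Z) = q) :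
    IsConstituent (ρ.simpleObject cU RU hRU δ)
        (ρ.tensorObj (ρ.simpleObject cY RY hRY π) (ρ.simpleObject cZ RZ hRZ γ)) ↔
      ∃ (t : G ⧸ ρ.inertia Y) (s : G ⧸ ρ.inertia Z),
        (∃ f : U ⟶ (ρ.F (RY t)).obj Y ⊗ (ρ.F (RZ s)).obj Z, f ≠ 0) ∧
        (δ.comap (ρ.toInertia U Y Z (RY t) (RZ s))).multiplicity
          (((π.comap (LinearAction.conjHom (RY t) _)).comap (ρ.toConjLeft U Y Z (RY t) (RZ s))).tensor
            (((γ.comap (LinearAction.conjHom (RZ s) _)).comap (ρ.toConjRight U Y Z (RY t) (RZ s))).tensor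
              (ρ.tau cU cY cZ (RY t) (RZ s)))) ≠ 0 := by
  rw [EquivariantObject.isConstituent_iff (ρ.simple_simpleObject cU δ RU hRU hδ),
    ρ.exists_simpleObject_hom_ne_zero_iff cU δ RU hRU]
  refine (ρ.exists_intertwiner_tensorHomAct_iff cU cY cZ δ π γ RY hRY RZ hRZ).trans ?_
  refine exists_congr fun q => exists_congr fun r => ?_
  rw [ProjRep.multiplicity_ne_zero_iff]
  -- Only (b) carries content: if the Hom space in (a) were zero, the tensor product containing it
  -- would be zero and so would every intertwiner.
  refine ⟨fun h => ⟨?_, h⟩, fun h => h.2⟩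
  obtain ⟨φ, h0, -⟩ := h
  by_contra! hf
  have : Subsingleton (ρ.FusionHom RY RZ U q r) := ⟨fun a b => (hf a).trans (hf b).symm⟩
  exact h0 (LinearMap.ext fun v => Subsingleton.elim _ _)
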